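/- For $x\in\mathbb{R}$ and $r\in\mathbb{N}$ (positive integers) write $e_r(x)=e^{2\pi i x/r}$. For $r,j\in\mathbb{N}$, real $L,M\ge 1$ and finite sequences $\boldsymbol{\alpha}=(\alpha_l)_{|l|\le L}$ (indexed by integers $l$) and $\boldsymbol{\beta}=(\beta_m)_{1\le m\le M}$ of complex numbers put $$\Sigma(r,j,L,M,\boldsymbol{\alpha},\boldsymbol{\beta})=\sum_{|l|\le L}\ \sum_{1\le m\le M}\ \sum_{\substack{k \bmod r\\ k^2\equiv jm \bmod r}}\alpha_l\,\beta_m\,e_r(lk),$$ $$\|\boldsymbol{\alpha}\|_2=\Big(\sum_{|l|\le L}|\alpha_l|^2\Big)^{1/2},\qquad \|\boldsymbol{\beta}\|_\infty=\max_{1\le m\le M}|\beta_m|.$$ Let $\varepsilon>0$. (i) There is a constant $C>0$ depending only on $\varepsilon$ such that, for all $r,j\in\mathbb{N}$ with $(r,j)=1$, all real $L,M$ with $1\le L\le r$ and $r^{1/3}\le M\le r$, and all $\boldsymbol{\alpha}$, $\boldsymbol{\beta}$ as above, $$|\Sigma(r,j,L,M,\boldsymbol{\alpha},\boldsymbol{\beta})|\le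 C\left(L^{1/2}M^{5/4}r^{-1/4}+L^{1/4}M^{7/8}r^{1/8}\right)\|\boldsymbol{\alpha}\|_2\,\|\boldsymbol{\beta}\|_\infty\, r^{\varepsilon}.$$ (ii) The bound is nontrivial when $r^{1/3+3\varepsilon}\le L,M\le r^{1-\varepsilon}$, in the sense that it saves a power of $r$ over $L^{1/2}M\|\boldsymbol{\alpha}\|_2\|\boldsymbol{\beta}\|_\infty$: there are $\delta>0$ and $C>0$ depending only on $\varepsilon$ such that, for all $r,j\in\mathbb{N}$ with $(r,j)=1$, all real $L,M$ with $r^{1/3+3\varepsilon}\le L\le r^{1-\varepsilon}$ and $r^{1/3+3\varepsilon}\le M\le r^{1-\varepsilon}$, and all $\boldsymbol{\alpha}$, $\boldsymbol{\beta}$, $$|\Sigma(r,j,L,M,\boldsymbol{\alpha},\boldsymbol{\beta})|\le C\,L^{1/2}M\,\|\boldsymbol{\alpha}\|_2\,\|\boldsymbol{\beta}\|_\infty\, r^{-\delta}.$$ -/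

import Mathlib

open Finset

noncomputable section

/-- The additive character `e(x) = exp (2 π i x)`. -/
def eChar (x : ℝ) : ℂ := Complex.exp (2 * Real.pi * Complex.I * x)

/-- `e_r(x) = e(x / r)`. -/
def eMod (r : ℕ) (x : ℝ) : ℂ := eChar (x / r)

/-- All modular square roots of `s` modulo `r`, i.e. all solutions `k` of `k² ≡ s mod r`,
each residue class being represented once, by its element of `{0, …, r - 1}`. -/
def modSqrt (r s : ℕ) : Finset ℕ := (range r).filter fun k => k ^ 2 ≡ s [MOD r]

/-- The integers `l` with `|l| ≤ L`. -/
def lRange (L : ℝ) : Finset ℤ := Icc (-⌊L⌋) ⌊L⌋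

/-- The natural numbers `m` with `1 ≤ m ≤ M`. -/
def mRange (M : ℝ) : Finset ℕ := Icc 1 ⌊M⌋₊

/-- The bilinear sum `∑_{|l| ≤ L} ∑_{1 ≤ m ≤ M} α_l β_m e_r(l √(jm))`, where `√(jm)` runs through
all modular square roots of `jm` modulo `r`. -/
def bilinearSum (r j : ℕ) (L M : ℝ) (α : ℤ → ℂ) (β : ℕ → ℂ) : ℂ :=
  ∑ l ∈ lRange L, ∑ m ∈ mRange M, ∑ k ∈ modSqrt r (j * m), α l * β m * eMod r (l * k)

/-- `‖α‖₂ = (∑_{|l| ≤ L} |α_l|²)^{1/2}`. -/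
def norm2 (L : ℝ) (α : ℤ → ℂ) : ℝ := Real.sqrt (∑ l ∈ lRange L, ‖α l‖ ^ 2)

/-- `‖β‖_∞ = max_{1 ≤ m ≤ M} |β_m|`. -/
def normInf (M : ℝ) (β : ℕ → ℂ) : ℝ := (((mRange M).sup fun m => ‖β m‖₊ : NNReal) : ℝ)

end

noncomputable section

/-! Cauchy–Schwarz over `l` reduces the bound to a second moment of the sum over the roots `k`. A
large sieve argument bounds that moment by `L ‖β‖_∞²` times the number of pairs of roots whose
difference lies in `(-H, H)`, where `H ≍ r / L` (`exists_sum_norm_sq_le_card_closePairs`). Splitting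
by `gcd (m, r)` reduces this count to `m` coprime to the modulus.

Let `k₁² = J m₁` and `k₂² = J m₂` with `m₁ ≠ m₂` up to `N`, and put `h = k₂ - k₁`, `c = h² / J`, `n
= m₂ - m₁`, `σ = m₁ + m₂`. Eliminating the roots gives `n² ≡ 2 c σ - c² mod r`. If many pairs share
`h`, differencing this relation twice, with a pigeonhole in between, yields `A ≡ 2 c s mod r` with
`A` and `s > 0` both small (`exists_short_vector`). Then `B = A - 2 s σ` satisfies `B² ≡ 16 s² m₁ m₂
mod r`, which no longer involves `h`. Pairs with a popular difference are thus controlled by triples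
`(s, B, m₁ m₂)` (`card_offPairs_le_card_quadTriples`). These are counted by fixing the value of `B²
- 16 s² P`, a multiple of `r`, and bounding square roots modulo `16 s²` in a short window
(`card_quadTriples_le`).

Up to divisor factors, `N² T / t` pairs have a difference attained at least `t` times, where `T = (1
+ N³ / r)^(1/2)`, while the unpopular differences contribute at most `H t`. Balancing gives `N (H
T)^(1/2)` close pairs. As `r ≤ M³`, this already yields `L^(1/4) M^(7/8) r^(1/8)` up to `r^ε`, so
the other term in (i) is added for free, and (ii) is a comparison of exponents. -/

/-! ### The divisor bound. -/

theorem add_one_le_mul_two_rpow {ε : ℝ} (hε : 0 < ε) (e : ℕ) :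
    (e : ℝ) + 1 ≤ (1 + 1 / (ε * Real.log 2)) * (2 : ℝ) ^ (ε * e) := by
  have hl : 0 < Real.log 2 := Real.log_pos (by norm_num)
  have h1 : 1 + ε * e * Real.log 2 ≤ (2 : ℝ) ^ (ε * e) := by
    rw [Real.rpow_def_of_pos (by norm_num : (0 : ℝ) < 2)]
    have := Real.add_one_le_exp (Real.log 2 * (ε * e))
    linarith
  have hp : 0 < ε * Real.log 2 := by positivity
  calc (e : ℝ) + 1 ≤ (1 + 1 / (ε * Real.log 2)) * (1 + ε * e * Real.log 2) := by
        have : (1 / (ε * Real.log 2)) * (ε * e * Real.log 2) = e := by field_simp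
        have h2 : 0 ≤ ε * e * Real.log 2 := by positivity
        have h3 : 0 ≤ 1 / (ε * Real.log 2) := by positivity
        nlinarith
    _ ≤ _ := by gcongr

/-- The divisor bound `τ(n) ≪ n ^ ε`. -/
theorem exists_card_divisors_le_rpow {ε : ℝ} (hε : 0 < ε) :
    ∃ C : ℝ, 1 ≤ C ∧ ∀ n : ℕ, 0 < n → (#n.divisors : ℝ) ≤ C * (n : ℝ) ^ ε := by
  set C₀ : ℝ := 1 + 1 / (ε * Real.log 2) with hC₀
  have hl : 0 < Real.log 2 := Real.log_pos (by norm_num)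
  have hC1 : 1 ≤ C₀ := by
    have : 0 ≤ 1 / (ε * Real.log 2) := by positivity
    linarith
  obtain ⟨B, hB⟩ := exists_nat_ge ((2 : ℝ) ^ (1 / ε))
  refine ⟨C₀ ^ B, one_le_pow₀ hC1, fun n hn => ?_⟩
  have hn0 : n ≠ 0 := hn.ne'
  -- Each prime below `B ≥ 2^(1/ε)` costs a factor `C₀`. The others have `p^ε ≥ 2`, so `e + 1 ≤ 2^e`
  -- suffices for them.
  have key : ∀ p ∈ n.primeFactors, ((n.factorization p : ℝ) + 1) ≤
      (if p < B then C₀ else 1) * ((p : ℝ) ^ n.factorization p) ^ ε := by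
    intro p hp
    have hp2 : (2 : ℝ) ≤ p := by exact_mod_cast (Nat.prime_of_mem_primeFactors hp).two_le
    set e := n.factorization p
    have hpow : ((p : ℝ) ^ e) ^ ε = (p : ℝ) ^ (ε * e) := by
      rw [← Real.rpow_natCast, ← Real.rpow_mul (by linarith)]; ring_nf
    rw [hpow]
    split_ifs with h
    · refine (add_one_le_mul_two_rpow hε e).trans ?_
      gcongr
    · rw [one_mul]
      have hpB : (2 : ℝ) ^ (1 / ε) ≤ p := hB.trans (by exact_mod_cast not_lt.mp h)
      have h2 : (2 : ℝ) ≤ (p : ℝ) ^ ε := by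
        calc (2 : ℝ) = ((2 : ℝ) ^ (1 / ε)) ^ ε := by
              rw [← Real.rpow_mul (by norm_num)]; field_simp; simp
          _ ≤ _ := by gcongr
      rw [Real.rpow_mul (by linarith), Real.rpow_natCast]
      calc (e : ℝ) + 1 ≤ (2 : ℝ) ^ e := by
            exact_mod_cast Nat.succ_le_of_lt (Nat.lt_two_pow_self)
        _ ≤ _ := by gcongr
  rw [Nat.card_divisors hn0]
  push_cast
  refine (prod_le_prod (fun p _ => by positivity) key).trans ?_
  rw [prod_mul_distrib]
  have hprod : ∏ p ∈ n.primeFactors, ((p : ℝ) ^ n.factorization p) ^ ε = (n : ℝ) ^ ε := by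
    rw [Real.finsetProd_rpow _ _ (fun p _ => by positivity)]
    congr 1
    conv_rhs => rw [← Nat.prod_factorization_pow_eq_self hn0]
    rw [Finsupp.prod]
    push_cast
    rfl
  rw [hprod]
  gcongr
  rw [prod_ite, prod_const_one, mul_one, prod_const]
  refine pow_le_pow_right₀ hC1 ?_
  calc #{p ∈ n.primeFactors | p < B} ≤ #(range B) := by
        refine card_le_card fun p hp => ?_
        simpa using (mem_filter.mp hp).2
    _ = B := card_range B

/-! ### Square roots to a modulus in short windows. -/

/-- Integers in a window of length `Λ` lying in one residue class modulo `m`. -/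
theorem card_le_of_dvd_sub {S : Finset ℤ} {m Λ : ℕ} (hm : 0 < m)
    (hd : ∀ x ∈ S, ∀ y ∈ S, (m : ℤ) ∣ y - x) (hΛ : ∀ x ∈ S, ∀ y ∈ S, y - x ≤ Λ) :
    #S ≤ Λ / m + 1 := by
  rcases S.eq_empty_or_nonempty with rfl | hne
  · simp
  have hmZ : (0 : ℤ) < m := by exact_mod_cast hm
  set x₀ := S.min' hne
  have hx₀ : x₀ ∈ S := S.min'_mem hne
  rw [← card_range (Λ / m + 1)]
  refine card_le_card_of_injOn (fun y => ((y - x₀) / m).toNat) ?_ ?_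
  · intro y hy
    have h1 : 0 ≤ y - x₀ := by linarith [S.min'_le y hy]
    have h2 : (y - x₀) / m ≤ (Λ : ℤ) / m := Int.ediv_le_ediv hmZ (hΛ _ hx₀ _ hy)
    have h3 : 0 ≤ (y - x₀) / m := Int.ediv_nonneg h1 hmZ.le
    simp only [coe_range, Set.mem_Iio]
    have : ((Λ / m : ℕ) : ℤ) = (Λ : ℤ) / m := by push_cast; rfl
    omega
  · intro y hy z hz hyz
    have h1 : ∀ w ∈ S, 0 ≤ (w - x₀) / m := fun w hw =>
      Int.ediv_nonneg (by linarith [S.min'_le w hw]) hmZ.le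
    have h2 : (y - x₀) / m = (z - x₀) / m := by
      have h3 := h1 y hy
      have h4 := h1 z hz
      simp only at hyz
      omega
    have h5 := Int.ediv_mul_cancel (hd _ hx₀ _ hy)
    have h6 := Int.ediv_mul_cancel (hd _ hx₀ _ hz)
    rw [h2] at h5
    linarith

/-- Square roots modulo `q` of an integer `a` in a window of length `Λ`. -/
theorem card_modular_roots_le {q : ℕ} (hq : 0 < q) {a : ℤ} {G Λ : ℕ}
    (hG : ∀ γ : ℕ, γ ^ 2 ∣ q → (γ : ℤ) ^ 2 ∣ 4 * a → γ ≤ G) {S : Finset ℤ}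
    (hS : ∀ B ∈ S, (q : ℤ) ∣ B ^ 2 - a) (hΛ : ∀ x ∈ S, ∀ y ∈ S, y - x ≤ Λ) :
    (#S : ℝ) ≤ #q.divisors * (1 + Λ * G / q) := by
  rcases S.eq_empty_or_nonempty with rfl | ⟨B₀, hB₀⟩
  · simp; positivity
  -- Roots are sorted by `δ = gcd (B - B₀, q)`. With `q = δ ε`, a fibre satisfies `B ≡ B₀ mod δ` and
  -- `B ≡ -B₀ mod ε`, so it lies in one class modulo `lcm (δ, ε) = q / γ`, where `γ = gcd (δ, ε)`.
  -- Moreover `γ ∣ 2 B₀`, whence `γ² ∣ 4 a` and `γ ≤ G`.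
  have hmaps : ∀ B ∈ S, Int.gcd (B - B₀) q ∈ q.divisors := fun B _ =>
    Nat.mem_divisors.mpr ⟨by exact_mod_cast Int.gcd_dvd_right (B - B₀) q, hq.ne'⟩
  rw [card_eq_sum_card_fiberwise hmaps]
  push_cast
  rw [← nsmul_eq_mul]
  refine sum_le_card_nsmul _ _ _ fun δ hδ => ?_
  obtain ⟨ε, rfl⟩ := (Nat.mem_divisors.mp hδ).1
  have hδ0 : 0 < δ := Nat.pos_of_mul_pos_right hq
  have hε0 : 0 < ε := Nat.pos_of_mul_pos_left hq
  set γ := Nat.gcd δ ε with hγ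
  have hγ0 : 0 < γ := Nat.gcd_pos_of_pos_left _ hδ0
  have hplus : ∀ B ∈ S, Int.gcd (B - B₀) (δ * ε : ℕ) = δ → (δ : ℤ) ∣ B - B₀ ∧ (ε : ℤ) ∣ B + B₀ := by
    intro B hB hg
    have h1 : (δ : ℤ) ∣ B - B₀ := by
      conv_lhs => rw [← hg]
      exact Int.gcd_dvd_left _ _
    refine ⟨h1, ?_⟩
    obtain ⟨t, ht⟩ := h1
    have hco : IsCoprime t (ε : ℤ) := by
      rw [Int.isCoprime_iff_gcd_eq_one]
      rw [ht] at hg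
      push_cast at hg
      rw [Int.gcd_mul_left, Int.natAbs_natCast] at hg
      exact Nat.eq_of_mul_eq_mul_left hδ0 (by simpa using hg)
    have h2 : ((δ * ε : ℕ) : ℤ) ∣ (B - B₀) * (B + B₀) := by
      exact (dvd_sub (hS B hB) (hS B₀ hB₀)).trans (dvd_of_eq (by ring))
    rw [ht] at h2
    push_cast at h2
    rw [mul_assoc] at h2
    have h3 := Int.dvd_of_mul_dvd_mul_left (by exact_mod_cast hδ0.ne') h2
    exact hco.symm.dvd_of_dvd_mul_left h3
  set F := {B ∈ S | Int.gcd (B - B₀) (δ * ε : ℕ) = δ} with hF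
  rcases F.eq_empty_or_nonempty with hFe | ⟨B₁, hB₁⟩
  · rw [hFe]; simp; positivity
  have hFS : ∀ B ∈ F, (δ : ℤ) ∣ B - B₀ ∧ (ε : ℤ) ∣ B + B₀ := fun B hB =>
    hplus B (mem_filter.mp hB).1 (mem_filter.mp hB).2
  have hγG : γ ≤ G := by
    apply hG
    · rw [sq]; exact Nat.mul_dvd_mul (Nat.gcd_dvd_left _ _) (Nat.gcd_dvd_right _ _)
    · have h1 : (γ : ℤ) ∣ 2 * B₀ := by
        have ha : (γ : ℤ) ∣ B₁ - B₀ :=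
          (Int.natCast_dvd_natCast.mpr (Nat.gcd_dvd_left δ ε)).trans (hFS _ hB₁).1
        have hb : (γ : ℤ) ∣ B₁ + B₀ :=
          (Int.natCast_dvd_natCast.mpr (Nat.gcd_dvd_right δ ε)).trans (hFS _ hB₁).2
        exact (dvd_sub hb ha).trans (dvd_of_eq (by ring))
      have h2 : (γ : ℤ) ^ 2 ∣ (2 * B₀) ^ 2 := pow_dvd_pow_of_dvd h1 2
      have h3 : (γ : ℤ) ^ 2 ∣ B₀ ^ 2 - a := by
        refine dvd_trans ?_ (hS _ hB₀)
        have : γ ^ 2 ∣ δ * ε := by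
          rw [sq]; exact Nat.mul_dvd_mul (Nat.gcd_dvd_left _ _) (Nat.gcd_dvd_right _ _)
        exact_mod_cast this
      exact (dvd_sub h2 (h3.mul_left 4)).trans (dvd_of_eq (by ring))
  have hlcm : 0 < Nat.lcm δ ε := Nat.lcm_pos hδ0 hε0
  have hcard : #F ≤ Λ / Nat.lcm δ ε + 1 := by
    refine card_le_of_dvd_sub hlcm ?_ ?_
    · intro x hx y hy
      have h1 : (δ : ℤ) ∣ y - x := by
        exact (dvd_sub (hFS y hy).1 (hFS x hx).1).trans (dvd_of_eq (by ring))
      have h2 : (ε : ℤ) ∣ y - x := by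
        exact (dvd_sub (hFS y hy).2 (hFS x hx).2).trans (dvd_of_eq (by ring))
      exact Int.natCast_dvd.mpr (Nat.lcm_dvd (Int.natCast_dvd.mp h1) (Int.natCast_dvd.mp h2))
    · exact fun x hx y hy => hΛ x (mem_filter.mp hx).1 y (mem_filter.mp hy).1
  have hgl : (γ : ℝ) * Nat.lcm δ ε = (δ * ε : ℕ) := by exact_mod_cast Nat.gcd_mul_lcm δ ε
  have hlR : (0 : ℝ) < Nat.lcm δ ε := by exact_mod_cast hlcm
  calc (#F : ℝ) ≤ ((Λ / Nat.lcm δ ε : ℕ) : ℝ) + 1 := by exact_mod_cast hcard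
    _ ≤ (Λ : ℝ) / Nat.lcm δ ε + 1 := by gcongr; exact Nat.cast_div_le
    _ = Λ * γ / (δ * ε : ℕ) + 1 := by
        rw [← hgl]
        have : (γ : ℝ) ≠ 0 := by positivity
        field_simp
    _ ≤ _ := by
        rw [add_comm]
        have : (γ : ℝ) ≤ G := by exact_mod_cast hγG
        gcongr

/-! ### From exponential sums to pairs of close frequencies. -/

/-- Pairs of elements of `X` whose first coordinates differ by less than `H` modulo `r`,
together with the difference. -/
def closePairs (r : ℕ) (X : Finset (ZMod r × ℕ)) (H : ℕ) :
    Finset (((ZMod r × ℕ) × (ZMod r × ℕ)) × ℤ) :=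
  {w ∈ (X ×ˢ X) ×ˢ Ioo (-(H : ℤ)) H | w.1.2.1 - w.1.1.1 = (w.2 : ZMod r)}

theorem eMod_eq_stdAddChar (r : ℕ) [NeZero r] (l : ℤ) (k : ℕ) :
    eMod r (l * k) = ZMod.stdAddChar ((l : ZMod r) * (k : ZMod r)) := by
  have := ZMod.stdAddChar_coe (N := r) (l * k)
  push_cast at this
  rw [this, eMod, eChar]
  push_cast
  ring_nf

/-- Open the square; orthogonality of characters modulo `r` keeps only coinciding frequencies. -/
theorem sum_norm_sq_addChar_le (r : ℕ) [NeZero r] {ι : Type*} (I : Finset ι) [DecidableEq ι]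
    (v : ι → ZMod r) (c : ι → ℂ) (b : ℝ) (hb : 0 ≤ b) (hc : ∀ i ∈ I, ‖c i‖ ≤ b) :
    ∑ t : ZMod r, ‖∑ i ∈ I, c i * ZMod.stdAddChar (t * v i)‖ ^ 2 ≤
      r * b ^ 2 * #{p ∈ I ×ˢ I | v p.1 = v p.2} := by
  have hexp : ((∑ t : ZMod r, ‖∑ i ∈ I, c i * ZMod.stdAddChar (t * v i)‖ ^ 2 : ℝ) : ℂ) =
      ∑ p ∈ I ×ˢ I, c p.1 * (starRingEnd ℂ) (c p.2) *
        (if v p.1 = v p.2 then (r : ℂ) else 0) := by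
    push_cast
    have : ∀ t : ZMod r, ((‖∑ i ∈ I, c i * ZMod.stdAddChar (t * v i)‖ : ℂ)) ^ 2 =
        ∑ p ∈ I ×ˢ I, c p.1 * (starRingEnd ℂ) (c p.2) *
          ZMod.stdAddChar (t * (v p.1 - v p.2)) := by
      intro t
      rw [← Complex.mul_conj', map_sum, sum_mul_sum, ← sum_product']
      refine sum_congr rfl fun p _ => ?_
      rw [map_mul (starRingEnd ℂ), ← AddChar.map_neg_eq_conj, mul_sub, sub_eq_add_neg,
        AddChar.map_add_eq_mul]
      ring
    simp_rw [this]
    rw [sum_comm]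
    refine sum_congr rfl fun p _ => ?_
    rw [← mul_sum]
    congr 1
    rw [AddChar.sum_mulShift _ (ZMod.isPrimitive_stdAddChar r)]
    simp [sub_eq_zero, ZMod.card]
  have hnn : 0 ≤ ∑ t : ZMod r, ‖∑ i ∈ I, c i * ZMod.stdAddChar (t * v i)‖ ^ 2 :=
    sum_nonneg fun _ _ => by positivity
  rw [← abs_of_nonneg hnn, ← Real.norm_eq_abs, ← Complex.norm_real, hexp]
  refine (norm_sum_le _ _).trans ?_
  rw [card_filter]
  push_cast
  rw [mul_sum]
  refine sum_le_sum fun p hp => ?_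
  obtain ⟨h1, h2⟩ := mem_product.mp hp
  rw [norm_mul, norm_mul, RCLike.norm_conj]
  split_ifs
  · rw [Complex.norm_natCast, mul_one]
    calc ‖c p.1‖ * ‖c p.2‖ * r ≤ b * b * r := by
          gcongr
          · exact hc _ h1
          · exact hc _ h2
      _ = _ := by ring
  · simp

/-- A window of length `2 Λ ≤ 2 r` meets each residue class at most three times. -/
theorem sum_Icc_le_three_mul (r : ℕ) [NeZero r] (g : ZMod r → ℝ) (hg : ∀ t, 0 ≤ g t) {Λ : ℕ}
    (hΛ : Λ ≤ r) : ∑ l ∈ Icc (-(Λ : ℤ)) Λ, g l ≤ 3 * ∑ t, g t := by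
  rw [← sum_fiberwise_of_maps_to (s := Icc (-(Λ : ℤ)) Λ) (t := univ)
    (g := fun l : ℤ => (l : ZMod r)) (fun _ _ => mem_univ _), mul_sum]
  refine sum_le_sum fun t _ => ?_
  have h1 : ∑ l ∈ Icc (-(Λ : ℤ)) Λ with ((l : ℤ) : ZMod r) = t, g l =
      ∑ l ∈ Icc (-(Λ : ℤ)) Λ with ((l : ℤ) : ZMod r) = t, g t :=
    sum_congr rfl fun l hl => by rw [(mem_filter.mp hl).2]
  rw [h1, sum_const, nsmul_eq_mul]
  gcongr
  · exact hg t
  have h2 : #{l ∈ Icc (-(Λ : ℤ)) Λ | ((l : ℤ) : ZMod r) = t} ≤ (2 * r) / r + 1 := by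
    refine card_le_of_dvd_sub (NeZero.pos r) ?_ ?_
    · intro x hx y hy
      rw [← ZMod.intCast_eq_intCast_iff_dvd_sub, (mem_filter.mp hx).2, (mem_filter.mp hy).2]
    · intro x hx y hy
      have h3 := mem_Icc.mp (mem_filter.mp hx).1
      have h4 := mem_Icc.mp (mem_filter.mp hy).1
      push_cast
      have : (Λ : ℤ) ≤ r := by exact_mod_cast hΛ
      linarith
  rw [Nat.mul_div_cancel _ (NeZero.pos r)] at h2
  exact_mod_cast h2

/-- All the angles are at most `2π / 8` in absolute value, so each term has real part at least `1 /
2`. -/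
theorem half_le_norm_sum_stdAddChar (r : ℕ) [NeZero r] (H : ℕ) (l : ℤ)
    (h : ∀ i < H, 8 * |(i : ℝ) * l| ≤ r) :
    (H : ℝ) / 2 ≤ ‖∑ i ∈ range H, (ZMod.stdAddChar ((l : ZMod r) * (i : ZMod r)) : ℂ)‖ := by
  refine le_trans ?_ (Complex.re_le_norm _)
  rw [Complex.re_sum]
  have : ∀ i ∈ range H, (1 : ℝ) / 2 ≤
      ((ZMod.stdAddChar ((l : ZMod r) * (i : ZMod r)) : ℂ)).re := by
    intro i hi
    have hr : (0 : ℝ) < r := by exact_mod_cast NeZero.pos r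
    rw [← eMod_eq_stdAddChar, eMod, eChar]
    have h1 : 2 * (Real.pi : ℂ) * Complex.I * ((l * i / r : ℝ) : ℂ) =
        ((2 * Real.pi * (l * i / r) : ℝ) : ℂ) * Complex.I := by push_cast; ring
    rw [h1, Complex.exp_ofReal_mul_I_re]
    refine le_trans ?_ (Real.one_sub_sq_div_two_le_cos)
    have h2 : |(l : ℝ) * i / r| ≤ 1 / 8 := by
      rw [abs_div, abs_of_pos hr, div_le_iff₀ hr, mul_comm (l : ℝ)]
      linarith [h i (mem_range.mp hi)]
    have h3 : ((l : ℝ) * i / r) ^ 2 ≤ (1 / 8) ^ 2 := sq_le_sq' (by linarith [neg_abs_le ((l : ℝ) * i / r)]) ((le_abs_self _).trans h2)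
    have h4 : Real.pi ^ 2 ≤ 10 := by nlinarith [Real.pi_lt_d2, Real.pi_pos]
    have h5 : (2 * Real.pi * ((l : ℝ) * i / r)) ^ 2 = 4 * (Real.pi ^ 2 * ((l : ℝ) * i / r) ^ 2) := by
      ring
    rw [h5]
    have h6 : Real.pi ^ 2 * ((l : ℝ) * i / r) ^ 2 ≤ 10 * (1 / 8) ^ 2 := by gcongr
    linarith
  calc (H : ℝ) / 2 = ∑ i ∈ range H, (1 : ℝ) / 2 := by simp [div_eq_mul_inv]
    _ ≤ _ := sum_le_sum this

/-- A large sieve type inequality: the second moment of an exponential sum over `|l| ≤ Λ` is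
controlled by the number of pairs of frequencies at distance less than about `r / Λ`. -/
theorem exists_sum_norm_sq_le_card_closePairs (r : ℕ) [NeZero r] {Λ : ℕ} (hΛ : 1 ≤ Λ)
    (hΛr : Λ ≤ r) : ∃ H : ℕ, 1 ≤ H ∧ H * Λ ≤ r ∧
      ∀ (X : Finset (ZMod r × ℕ)) (β : ℕ → ℂ) (b : ℝ), 0 ≤ b → (∀ x ∈ X, ‖β x.2‖ ≤ b) →
        ∑ l ∈ Icc (-(Λ : ℤ)) Λ, ‖∑ x ∈ X, β x.2 * ZMod.stdAddChar ((l : ZMod r) * x.1)‖ ^ 2 ≤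
          192 * Λ * b ^ 2 * #(closePairs r X H) := by
  have hΛ0 : 0 < Λ := hΛ
  -- `H = ⌊r / (8 Λ)⌋`, replaced by `1` when this vanishes. The shifts `i < H` then stay in phase
  -- for all `|l| ≤ Λ`, while `H ≥ r / (16 Λ)`.
  have hH : ∃ H : ℕ, 1 ≤ H ∧ H * Λ ≤ r ∧ r ≤ H * (16 * Λ) ∧ ∀ i < H, 8 * (i * Λ) ≤ r := by
    rcases le_or_gt (8 * Λ) r with h | h
    · have h1 : 1 ≤ r / (8 * Λ) := (Nat.one_le_div_iff (by positivity)).mpr h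
      have h2 : r / (8 * Λ) * (8 * Λ) ≤ r := Nat.div_mul_le_self _ _
      refine ⟨r / (8 * Λ), h1, by nlinarith, ?_, fun i hi => by nlinarith⟩
      have := Nat.lt_div_mul_add (a := r) (show 0 < 8 * Λ by positivity)
      nlinarith
    · refine ⟨1, le_rfl, by omega, by omega, fun i hi => ?_⟩
      obtain rfl : i = 0 := by omega
      simp
  obtain ⟨H, hH1, hHΛ, hHr, hHi⟩ := hH
  refine ⟨H, hH1, hHΛ, fun X β b hb hβ => ?_⟩
  have hH0 : (0 : ℝ) < H := by exact_mod_cast hH1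
  -- Each frequency is replaced by its `H` translates. This multiplies the sum by a kernel of size
  -- at least `H / 2` on `|l| ≤ Λ`, and two translates coincide only if the original frequencies
  -- differ by less than `H`.
  set I := range H ×ˢ X with hI
  set v : ℕ × (ZMod r × ℕ) → ZMod r := fun i => (i.1 : ZMod r) + i.2.1 with hv
  have hconv : ∀ t : ZMod r, ∑ i ∈ I, β i.2.2 * ZMod.stdAddChar (t * v i) =
      (∑ i ∈ range H, (ZMod.stdAddChar (t * (i : ZMod r)) : ℂ)) *
        ∑ x ∈ X, β x.2 * ZMod.stdAddChar (t * x.1) := by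
    intro t
    rw [sum_mul_sum, ← sum_product']
    refine sum_congr rfl fun i _ => ?_
    rw [hv, mul_add, AddChar.map_add_eq_mul]
    ring
  have hpt : ∀ l ∈ Icc (-(Λ : ℤ)) Λ,
      ‖∑ x ∈ X, β x.2 * ZMod.stdAddChar ((l : ZMod r) * x.1)‖ ^ 2 ≤
        4 / (H : ℝ) ^ 2 * ‖∑ i ∈ I, β i.2.2 * ZMod.stdAddChar ((l : ZMod r) * v i)‖ ^ 2 := by
    intro l hl
    rw [hconv, norm_mul, mul_pow]
    have hlb := half_le_norm_sum_stdAddChar r H l (by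
      intro i hi
      have h1 : |(l : ℝ)| ≤ Λ := by
        rw [abs_le]
        have := mem_Icc.mp hl
        exact ⟨by exact_mod_cast this.1, by exact_mod_cast this.2⟩
      have h2 : (8 : ℝ) * (i * Λ) ≤ r := by exact_mod_cast hHi i hi
      rw [abs_mul, Nat.abs_cast]
      refine le_trans ?_ h2
      gcongr)
    have h3 : ((H : ℝ) / 2) ^ 2 ≤
        ‖∑ i ∈ range H, (ZMod.stdAddChar ((l : ZMod r) * (i : ZMod r)) : ℂ)‖ ^ 2 := by
      gcongr
    have h4 : (1 : ℝ) ≤ 4 / (H : ℝ) ^ 2 *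
        ‖∑ i ∈ range H, (ZMod.stdAddChar ((l : ZMod r) * (i : ZMod r)) : ℂ)‖ ^ 2 := by
      rw [div_mul_eq_mul_div, le_div_iff₀ (by positivity)]
      linarith
    rw [← mul_assoc]
    exact le_mul_of_one_le_left (by positivity) h4
  -- A coincidence is recovered from the first shift, the two frequencies and the difference of the
  -- shifts.
  have hcount : #{p ∈ I ×ˢ I | v p.1 = v p.2} ≤ H * #(closePairs r X H) := by
    rw [← card_range H, ← card_product, card_range]
    refine card_le_card_of_injOn
      (fun p => (p.1.1, ((p.2.2, p.1.2), (p.2.1 : ℤ) - p.1.1))) ?_ ?_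
    · rintro ⟨⟨i, x⟩, ⟨i', x'⟩⟩ hp
      simp only [hI, hv, coe_filter, Set.mem_ofPred_eq, mem_product, mem_range] at hp
      obtain ⟨⟨⟨hi, hx⟩, hi', hx'⟩, he⟩ := hp
      simp only [closePairs, coe_product, Set.mem_prod, mem_coe, mem_range, mem_filter,
        mem_product, mem_Ioo]
      refine ⟨hi, ⟨⟨hx', hx⟩, by omega, by omega⟩, ?_⟩
      push_cast
      linear_combination he
    · rintro ⟨⟨i, x⟩, ⟨i', x'⟩⟩ _ ⟨⟨j, y⟩, ⟨j', y'⟩⟩ _ h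
      simp only [Prod.mk.injEq] at h ⊢
      obtain ⟨rfl, ⟨rfl, rfl⟩, h⟩ := h
      exact ⟨⟨rfl, rfl⟩, by omega, rfl⟩
  calc ∑ l ∈ Icc (-(Λ : ℤ)) Λ, ‖∑ x ∈ X, β x.2 * ZMod.stdAddChar ((l : ZMod r) * x.1)‖ ^ 2
      ≤ ∑ l ∈ Icc (-(Λ : ℤ)) Λ, 4 / (H : ℝ) ^ 2 *
          ‖∑ i ∈ I, β i.2.2 * ZMod.stdAddChar ((l : ZMod r) * v i)‖ ^ 2 := sum_le_sum hpt
    _ ≤ 3 * ∑ t : ZMod r, 4 / (H : ℝ) ^ 2 *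
          ‖∑ i ∈ I, β i.2.2 * ZMod.stdAddChar (t * v i)‖ ^ 2 :=
        sum_Icc_le_three_mul r (fun t => 4 / (H : ℝ) ^ 2 *
          ‖∑ i ∈ I, β i.2.2 * ZMod.stdAddChar (t * v i)‖ ^ 2) (fun _ => by positivity) hΛr
    _ = 12 / (H : ℝ) ^ 2 * ∑ t : ZMod r, ‖∑ i ∈ I, β i.2.2 * ZMod.stdAddChar (t * v i)‖ ^ 2 := by
        rw [← mul_sum]; ring
    _ ≤ 12 / (H : ℝ) ^ 2 * (r * b ^ 2 * #{p ∈ I ×ˢ I | v p.1 = v p.2}) := by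
        gcongr
        exact sum_norm_sq_addChar_le r I v (fun i => β i.2.2) b hb
          fun i hi => hβ _ (mem_product.mp hi).2
    _ ≤ 12 / (H : ℝ) ^ 2 * ((H * (16 * Λ)) * b ^ 2 * (H * #(closePairs r X H))) := by
        gcongr
        · exact_mod_cast hHr
        · exact_mod_cast hcount
    _ = _ := by field_simp; ring

/-! ### Counting the triples `(s, B, P)`. -/

/-- `Δ` dominates the divisor function and the logarithm on a polynomial range in `r`. -/
structure DominatesDivisors (Δ : ℝ) (r : ℕ) : Prop where
  one_le : 1 ≤ Δ
  card_divisors_le : ∀ n : ℕ, 0 < n → n ≤ 2400 * r ^ 4 → (#n.divisors : ℝ) ≤ Δ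
  log_le : ∀ n : ℕ, 0 < n → n ≤ 16 * r → 1 + Real.log n ≤ Δ

/-- Triples `(s, B, P)` in a box with `B² - 16 s² P` divisible by `r`. -/
def quadTriples (r N a : ℕ) : Finset (ℕ × ℤ × ℕ) :=
  {x ∈ Icc 1 (4 * N) ×ˢ Icc (-(18 * N ^ 2 : ℤ)) (18 * N ^ 2) ×ˢ Icc 1 (N ^ 2) |
    x.1 * a ≤ 4 * N ∧ |x.2.1| * a ≤ 18 * N ^ 2 ∧
      (r : ℤ) ∣ x.2.1 ^ 2 - 16 * (x.1 : ℤ) ^ 2 * x.2.2}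

/-- Here `B² = (4 s)² P` makes `P` a square and `B = ± 4 s √P`, so a triple is determined by `s ≤ 4
N / a` and an integer `B / (4 s)` in `[-N, N]`. -/
theorem card_quadTriples_eq_zero_le {r N a : ℕ} (hN : 1 ≤ N) (ha : 0 < a) :
    (#{x ∈ quadTriples r N a | x.2.1 ^ 2 - 16 * (x.1 : ℤ) ^ 2 * x.2.2 = 0} : ℝ) ≤
      12 * (N : ℝ) ^ 2 / a := by
  have hpar : ∀ s : ℕ, ∀ B : ℤ, ∀ P : ℕ, 0 < s → B ^ 2 - 16 * (s : ℤ) ^ 2 * P = 0 →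
      4 * (s : ℤ) * (B / (4 * s)) = B ∧ (B / (4 * s)) ^ 2 = P := by
    intro s B P hs h
    have h1 : (4 * (s : ℤ)) ^ 2 ∣ B ^ 2 := ⟨P, by linarith⟩
    have h2 : 4 * (s : ℤ) ∣ B := (Int.pow_dvd_pow_iff two_ne_zero).mp h1
    have h3 := Int.mul_ediv_cancel' h2
    refine ⟨h3, ?_⟩
    have h4 : (16 * (s : ℤ) ^ 2) * ((B / (4 * s)) ^ 2) = (16 * (s : ℤ) ^ 2) * P := by
      calc _ = (4 * (s : ℤ) * (B / (4 * s))) ^ 2 := by ring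
        _ = B ^ 2 := by rw [h3]
        _ = _ := by linarith
    exact mul_left_cancel₀ (by positivity) h4
  have hcard : #{x ∈ quadTriples r N a | x.2.1 ^ 2 - 16 * (x.1 : ℤ) ^ 2 * x.2.2 = 0} ≤
      #(Icc 1 (4 * N / a) ×ˢ Icc (-(N : ℤ)) N) := by
    refine card_le_card_of_injOn (fun x => (x.1, x.2.1 / (4 * x.1))) ?_ ?_
    · rintro ⟨s, B, P⟩ hx
      simp only [quadTriples, coe_filter, mem_filter, mem_product, mem_Icc,
        Set.mem_ofPred_eq] at hx
      obtain ⟨⟨⟨hs, hB, hP⟩, hsa, hBa, hd⟩, h0⟩ := hx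
      obtain ⟨h1, h2⟩ := hpar s B P (by omega) h0
      simp only [coe_product, Set.mem_prod, mem_coe, mem_Icc]
      refine ⟨⟨hs.1, (Nat.le_div_iff_mul_le ha).mpr hsa⟩, ?_⟩
      rw [← abs_le]
      refine abs_le_of_sq_le_sq ?_ (by positivity)
      rw [h2]
      exact_mod_cast hP.2
    · rintro ⟨s, B, P⟩ hx ⟨s', B', P'⟩ hx' h
      simp only [quadTriples, coe_filter, mem_filter, mem_product, mem_Icc,
        Set.mem_ofPred_eq] at hx hx'
      obtain ⟨h1, h2⟩ := hpar s B P (by omega) hx.2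
      obtain ⟨h1', h2'⟩ := hpar s' B' P' (by omega) hx'.2
      simp only [Prod.mk.injEq] at h ⊢
      obtain ⟨rfl, h⟩ := h
      rw [h] at h1 h2
      refine ⟨rfl, h1.symm.trans h1', ?_⟩
      exact_mod_cast h2.symm.trans h2'
  rw [card_product, Nat.card_Icc, Int.card_Icc] at hcard
  have h1 : ((N : ℤ) + 1 - -(N : ℤ)).toNat = 2 * N + 1 := by omega
  rw [h1, Nat.add_sub_cancel] at hcard
  have h2 : ((4 * N / a : ℕ) : ℝ) ≤ 4 * N / a := by
    refine Nat.cast_div_le.trans (by push_cast; rfl)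
  have hN' : (1 : ℝ) ≤ N := by exact_mod_cast hN
  calc _ ≤ ((4 * N / a * (2 * N + 1) : ℕ) : ℝ) := by exact_mod_cast hcard
    _ = ((4 * N / a : ℕ) : ℝ) * (2 * N + 1) := by push_cast; ring
    _ ≤ (4 * N / a) * (3 * N) := by gcongr; linarith
    _ = _ := by ring

/-- With `4 s = γ q`, the sum becomes a part of the harmonic sum over `q ≤ 4 Z`. -/
theorem sum_div_of_dvd_le {Z γ : ℕ} (hγ : 0 < γ) :
    ∑ s ∈ Icc 1 Z with γ ∣ 4 * s, (γ : ℝ) / (4 * s) ≤ 1 + Real.log (4 * Z) := by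
  have h1 : ∑ s ∈ Icc 1 Z with γ ∣ 4 * s, (γ : ℝ) / (4 * s) ≤
      ∑ q ∈ Icc 1 (4 * Z), (q : ℝ)⁻¹ := by
    have hinj : Set.InjOn (fun s => 4 * s / γ) ({s ∈ Icc 1 Z | γ ∣ 4 * s} : Finset ℕ) := by
      intro s hs s' hs' h
      have h2 := Nat.div_mul_cancel (mem_filter.mp hs).2
      have h3 := Nat.div_mul_cancel (mem_filter.mp hs').2
      simp only at h
      rw [h] at h2
      omega
    have h2 : ∑ s ∈ Icc 1 Z with γ ∣ 4 * s, (γ : ℝ) / (4 * s) =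
        ∑ q ∈ ({s ∈ Icc 1 Z | γ ∣ 4 * s}).image (fun s => 4 * s / γ), (q : ℝ)⁻¹ := by
      rw [sum_image hinj]
      refine sum_congr rfl fun s hs => ?_
      rw [Nat.cast_div (mem_filter.mp hs).2 (by positivity)]
      push_cast
      rw [inv_div]
    rw [h2]
    refine sum_le_sum_of_subset_of_nonneg ?_ (fun _ _ _ => by positivity)
    intro q hq
    obtain ⟨s, hs, rfl⟩ := mem_image.mp hq
    obtain ⟨hs1, hs2⟩ := mem_filter.mp hs
    have hs3 := mem_Icc.mp hs1
    refine mem_Icc.mpr ⟨?_, ?_⟩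
    · exact Nat.div_pos (Nat.le_of_dvd (by omega) hs2) hγ
    · exact (Nat.div_le_self _ _).trans (by omega)
  refine h1.trans ?_
  have h3 := harmonic_le_one_add_log (4 * Z)
  rw [harmonic_eq_sum_Icc] at h3
  push_cast at h3
  exact h3

/-- Each `B` is a nonnegative root of `c` modulo `16 s²`, and `B²` stays in an interval of length
`16 s² N²`, so `B` stays in one of length `4 s N`. The loss `G` of `card_modular_roots_le` is
bounded by a sum over the admissible `γ` rather than a maximum, because it is averaged over `s`
later. -/
theorem card_roots_window_le {Δ : ℝ} {s N : ℕ} (hs : 0 < s) {c : ℤ} (hc : c ≠ 0)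
    (hΔ : (#(16 * s ^ 2).divisors : ℝ) ≤ Δ) {F : Finset ℤ}
    (hF : ∀ B ∈ F, 0 ≤ B ∧ ∃ P : ℕ, 1 ≤ P ∧ P ≤ N ^ 2 ∧ B ^ 2 - 16 * (s : ℤ) ^ 2 * P = c) :
    (#F : ℝ) ≤ Δ * (1 + N * ∑ γ ∈ (4 * c.natAbs).divisors with γ ∣ 4 * s, (γ : ℝ) / (4 * s)) := by
  set D := {γ ∈ (4 * c.natAbs).divisors | γ ∣ 4 * s} with hD
  have hG : ∀ γ : ℕ, γ ^ 2 ∣ 16 * s ^ 2 → (γ : ℤ) ^ 2 ∣ 4 * c → γ ≤ ∑ γ ∈ D, γ := by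
    intro γ h1 h2
    refine single_le_sum (f := fun γ : ℕ => γ) (fun _ _ => Nat.zero_le _) (mem_filter.mpr ⟨?_, ?_⟩)
    · refine Nat.mem_divisors.mpr ⟨?_, by positivity⟩
      have h3 : (γ : ℤ) ∣ 4 * c := (dvd_pow_self _ two_ne_zero).trans h2
      have h4 := Int.natCast_dvd.mp h3
      rwa [Int.natAbs_mul] at h4
    · refine (Nat.pow_dvd_pow_iff two_ne_zero).mp (h1.trans (dvd_of_eq (by ring)))
  have hmain := card_modular_roots_le (q := 16 * s ^ 2) (a := c) (Λ := 4 * s * N)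
    (by positivity) hG (S := F) ?_ ?_
  · refine hmain.trans ?_
    have hsR : (0 : ℝ) < s := by exact_mod_cast hs
    have h5 : ((4 * s * N : ℕ) : ℝ) * ((∑ γ ∈ D, γ : ℕ) : ℝ) / ((16 * s ^ 2 : ℕ) : ℝ) =
        N * ∑ γ ∈ D, (γ : ℝ) / (4 * s) := by
      rw [← sum_div]
      push_cast
      field_simp
      ring
    rw [h5]
    gcongr
  · intro B hB
    obtain ⟨-, P, -, -, h⟩ := hF B hB
    exact ⟨P, by push_cast; linarith⟩
  · intro x hx y hy
    obtain ⟨hx0, P, hP1, hP2, h⟩ := hF x hx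
    obtain ⟨hy0, P', hP1', hP2', h'⟩ := hF y hy
    by_contra hcon
    push Not at hcon
    push_cast at hcon
    have h1 : (4 * (s : ℤ) * N) ^ 2 < (y - x) ^ 2 := by
      have : (0 : ℤ) ≤ 4 * s * N := by positivity
      exact pow_lt_pow_left₀ hcon this two_ne_zero
    have h2 : (y - x) ^ 2 ≤ y ^ 2 - x ^ 2 := by
      have : x ≤ y := by
        have : (0 : ℤ) ≤ 4 * s * N := by positivity
        linarith
      nlinarith
    have h3 : (P' : ℤ) - P ≤ N ^ 2 := by
      have : (P' : ℤ) ≤ N ^ 2 := by exact_mod_cast hP2'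
      have : (0 : ℤ) ≤ P := by positivity
      linarith
    have h4 : 16 * (s : ℤ) ^ 2 * (P' - P) ≤ 16 * (s : ℤ) ^ 2 * N ^ 2 := by gcongr
    nlinarith

/-- For fixed `s` and sign of `B`, the triple is determined by `B`, to which the window bound
applies. Summing over `s`, the `γ` terms contribute a divisor count times a harmonic sum, hence
`Δ²`. -/
theorem card_quadTriples_eq_le {Δ : ℝ} {Z N : ℕ} {c : ℤ} (hc : c ≠ 0)
    (hΔ0 : 0 ≤ Δ) (hΔ : ∀ s ∈ Icc 1 Z, (#(16 * s ^ 2).divisors : ℝ) ≤ Δ)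
    (hΔc : (#(4 * c.natAbs).divisors : ℝ) ≤ Δ) (hlog : 1 + Real.log (4 * Z) ≤ Δ)
    {T : Finset (ℕ × ℤ × ℕ)}
    (hT : ∀ x ∈ T, x.1 ∈ Icc 1 Z ∧ 1 ≤ x.2.2 ∧ x.2.2 ≤ N ^ 2 ∧
      x.2.1 ^ 2 - 16 * (x.1 : ℤ) ^ 2 * x.2.2 = c) :
    (#T : ℝ) ≤ 2 * Δ * (Z + N * Δ ^ 2) := by
  have hfib : ∀ s ∈ Icc 1 Z, (#{x ∈ T | x.1 = s} : ℝ) ≤ 2 * (Δ * (1 + N *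
      ∑ γ ∈ (4 * c.natAbs).divisors with γ ∣ 4 * s, (γ : ℝ) / (4 * s))) := by
    intro s hs
    have hs0 : 0 < s := by have := mem_Icc.mp hs; omega
    have hone : ∀ e : ℤ, e ^ 2 = 1 → (#{x ∈ T | x.1 = s ∧ 0 ≤ e * x.2.1} : ℝ) ≤ Δ * (1 + N *
        ∑ γ ∈ (4 * c.natAbs).divisors with γ ∣ 4 * s, (γ : ℝ) / (4 * s)) := by
      intro e he
      have he0 : e ≠ 0 := by rintro rfl; norm_num at he
      have hinj : Set.InjOn (fun x : ℕ × ℤ × ℕ => e * x.2.1)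
          ({x ∈ T | x.1 = s ∧ 0 ≤ e * x.2.1} : Finset _) := by
        rintro ⟨s₁, B₁, P₁⟩ h₁ ⟨s₂, B₂, P₂⟩ h₂ h
        simp only [coe_filter, Set.mem_ofPred_eq] at h₁ h₂
        obtain ⟨hT₁, rfl, -⟩ := h₁
        obtain ⟨hT₂, rfl, -⟩ := h₂
        have h3 : B₁ = B₂ := mul_left_cancel₀ he0 h
        subst h3
        have e1 := (hT _ hT₁).2.2.2
        have e2 := (hT _ hT₂).2.2.2
        simp only at e1 e2
        have h4 : 16 * (s₂ : ℤ) ^ 2 * P₁ = 16 * (s₂ : ℤ) ^ 2 * P₂ := by linarith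
        have h5 := mul_left_cancel₀ (by positivity) h4
        simpa using h5
      rw [← card_image_of_injOn hinj]
      refine card_roots_window_le hs0 hc (hΔ s hs) ?_
      intro B hB
      obtain ⟨⟨s', B', P⟩, hx, rfl⟩ := mem_image.mp hB
      obtain ⟨hxT, rfl, hx0⟩ := mem_filter.mp hx
      obtain ⟨-, h1, h2, h3⟩ := hT _ hxT
      refine ⟨hx0, P, h1, h2, ?_⟩
      rw [mul_pow, he, one_mul]
      exact h3
    have hsub : {x ∈ T | x.1 = s} ⊆
        {x ∈ T | x.1 = s ∧ 0 ≤ 1 * x.2.1} ∪ {x ∈ T | x.1 = s ∧ 0 ≤ -1 * x.2.1} := by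
      intro x hx
      obtain ⟨h1, h2⟩ := mem_filter.mp hx
      rw [mem_union, mem_filter, mem_filter]
      rcases le_total 0 x.2.1 with h | h
      · exact Or.inl ⟨h1, h2, by linarith⟩
      · exact Or.inr ⟨h1, h2, by linarith⟩
    have hc1 : (#{x ∈ T | x.1 = s} : ℝ) ≤ #{x ∈ T | x.1 = s ∧ 0 ≤ 1 * x.2.1} +
        #{x ∈ T | x.1 = s ∧ 0 ≤ -1 * x.2.1} := by
      exact_mod_cast (card_le_card hsub).trans (card_union_le _ _)
    linarith [hone 1 (by norm_num), hone (-1) (by norm_num)]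
  rw [card_eq_sum_card_fiberwise (f := fun x : ℕ × ℤ × ℕ => x.1) (t := Icc 1 Z)
    (fun x hx => (hT x hx).1)]
  push_cast
  refine (sum_le_sum hfib).trans ?_
  rw [← mul_sum, ← mul_sum, sum_add_distrib, ← mul_sum]
  simp only [sum_const, Nat.card_Icc, nsmul_eq_mul, Nat.add_sub_cancel, mul_one]
  have hswap : ∑ s ∈ Icc 1 Z, ∑ γ ∈ (4 * c.natAbs).divisors with γ ∣ 4 * s, (γ : ℝ) / (4 * s) ≤
      Δ ^ 2 := by
    have : ∑ s ∈ Icc 1 Z, ∑ γ ∈ (4 * c.natAbs).divisors with γ ∣ 4 * s, (γ : ℝ) / (4 * s) =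
        ∑ γ ∈ (4 * c.natAbs).divisors, ∑ s ∈ Icc 1 Z with γ ∣ 4 * s, (γ : ℝ) / (4 * s) := by
      simp_rw [sum_filter]
      exact sum_comm
    rw [this]
    calc _ ≤ ∑ γ ∈ (4 * c.natAbs).divisors, Δ := sum_le_sum fun γ hγ =>
          (sum_div_of_dvd_le (Nat.pos_of_mem_divisors hγ)).trans hlog
      _ = #(4 * c.natAbs).divisors * Δ := by rw [sum_const, nsmul_eq_mul]
      _ ≤ Δ * Δ := by gcongr
      _ = _ := by ring
  rw [← mul_assoc]
  gcongr

/-- The nonzero values of `B² - 16 s² P` are multiples of `r` of size at most `(18² + 256) N⁴ / a² =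
580 N⁴ / a²`; each of them is attained `O(Δ³ N)` times. -/
theorem card_quadTriples_le {Δ : ℝ} {r N a : ℕ} (hΔ : DominatesDivisors Δ r) (hr : 0 < r)
    (hN : 1 ≤ N) (hNr : N ≤ r) (ha : 0 < a) :
    (#(quadTriples r N a) : ℝ) ≤
      12 * (N : ℝ) ^ 2 / a + 11600 * Δ ^ 3 * (N ^ 5 / (a ^ 2 * r)) := by
  have hΔ1 := hΔ.one_le
  have hrR : (0 : ℝ) < r := by exact_mod_cast hr
  have haR : (0 : ℝ) < a := by exact_mod_cast ha
  set f : ℕ × ℤ × ℕ → ℤ := fun x => x.2.1 ^ 2 - 16 * (x.1 : ℤ) ^ 2 * x.2.2 with hf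
  rw [← card_filter_add_card_filter_not (s := quadTriples r N a) (fun x => f x = 0)]
  push_cast
  refine add_le_add (card_quadTriples_eq_zero_le hN ha) ?_
  set T := {x ∈ quadTriples r N a | ¬ f x = 0} with hT
  have hmem : ∀ x ∈ T, f x ≠ 0 ∧ (r : ℤ) ∣ f x ∧ (f x).natAbs * a ^ 2 ≤ 580 * N ^ 4 ∧
      x.1 ∈ Icc 1 (4 * N / a) ∧ 1 ≤ x.2.2 ∧ x.2.2 ≤ N ^ 2 := by
    rintro ⟨s, B, P⟩ hx
    simp only [hT, quadTriples, mem_filter, mem_product, mem_Icc] at hx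
    obtain ⟨⟨⟨hs, hB, hP⟩, hsa, hBa, hd⟩, h0⟩ := hx
    refine ⟨h0, hd, ?_, mem_Icc.mpr ⟨hs.1, (Nat.le_div_iff_mul_le ha).mpr hsa⟩, hP.1, hP.2⟩
    have h1 : (B * a) ^ 2 ≤ (18 * (N : ℤ) ^ 2) ^ 2 := by
      rw [sq_le_sq, abs_mul, abs_of_nonneg (by positivity : (0 : ℤ) ≤ a),
        abs_of_nonneg (by positivity : (0 : ℤ) ≤ 18 * (N : ℤ) ^ 2)]
      exact hBa
    have h2 : 16 * ((s : ℤ) * a) ^ 2 * P ≤ 16 * (4 * (N : ℤ)) ^ 2 * N ^ 2 := by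
      have h3 : (s : ℤ) * a ≤ 4 * N := by exact_mod_cast hsa
      have h4 : (P : ℤ) ≤ N ^ 2 := by exact_mod_cast hP.2
      gcongr
    have h5 : (0 : ℤ) ≤ 16 * ((s : ℤ) * a) ^ 2 * P := by positivity
    zify
    have h6 : |f (s, B, P)| * (a : ℤ) ^ 2 = |(B * a) ^ 2 - 16 * ((s : ℤ) * a) ^ 2 * P| := by
      rw [← abs_of_nonneg (by positivity : (0 : ℤ) ≤ (a : ℤ) ^ 2), ← abs_mul]
      congr 1
      simp only [hf]
      ring
    rw [h6, abs_le]
    constructor <;> nlinarith [sq_nonneg (B * a : ℤ)]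
  set Q : ℕ := 580 * N ^ 4 / (a ^ 2 * r) with hQ
  have hQR : (Q : ℝ) ≤ 580 * (N : ℝ) ^ 4 / (a ^ 2 * r) := by
    refine Nat.cast_div_le.trans (by push_cast; rfl)
  have hmaps : ∀ x ∈ T, f x / r ∈ (Icc (-(Q : ℤ)) Q).erase 0 := by
    intro x hx
    obtain ⟨h0, hd, hle, -⟩ := hmem x hx
    obtain ⟨u, hu⟩ := hd
    have hrZ : (r : ℤ) ≠ 0 := by exact_mod_cast hr.ne'
    rw [hu, Int.mul_ediv_cancel_left _ hrZ, mem_erase, mem_Icc, ← abs_le]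
    refine ⟨fun h => h0 (by rw [hu, h, mul_zero]), ?_⟩
    rw [Int.abs_eq_natAbs]
    norm_cast
    rw [hQ, Nat.le_div_iff_mul_le (by positivity)]
    rw [hu, Int.natAbs_mul, Int.natAbs_natCast] at hle
    calc _ = r * u.natAbs * a ^ 2 := by ring
      _ ≤ _ := hle
  have hfib : ∀ u ∈ (Icc (-(Q : ℤ)) Q).erase 0, (#{x ∈ T | f x / r = u} : ℝ) ≤
      10 * Δ ^ 3 * N := by
    intro u hu
    rcases ({x ∈ T | f x / r = u}).eq_empty_or_nonempty with he | ⟨x₀, hx₀⟩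
    · rw [he]; simp; positivity
    obtain ⟨hx₀T, hx₀u⟩ := mem_filter.mp hx₀
    obtain ⟨h0, hd, hle, hsZ, -⟩ := hmem x₀ hx₀T
    set c := f x₀
    have hZ : 0 < 4 * N / a := by have := mem_Icc.mp hsZ; omega
    have hZN : 4 * N / a ≤ 4 * N := Nat.div_le_self _ _
    have hfc : ∀ x ∈ ({x ∈ T | f x / r = u}), f x = c := by
      intro x hx
      obtain ⟨hxT, hxu⟩ := mem_filter.mp hx
      rw [← Int.ediv_mul_cancel (hmem x hxT).2.1, hxu, ← hx₀u, Int.ediv_mul_cancel hd]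
    have hbound := card_quadTriples_eq_le (Δ := Δ) (Z := 4 * N / a) (N := N) h0 (by linarith)
      (T := {x ∈ T | f x / r = u}) ?_ ?_ ?_ ?_
    · refine hbound.trans ?_
      have h1 : ((4 * N / a : ℕ) : ℝ) ≤ 4 * N := by exact_mod_cast hZN
      have h2 : (1 : ℝ) ≤ Δ ^ 2 := one_le_pow₀ hΔ1
      have h3 : (4 : ℝ) * N ≤ 4 * N * Δ ^ 2 := le_mul_of_one_le_right (by positivity) h2
      calc _ ≤ 2 * Δ * (4 * N * Δ ^ 2 + N * Δ ^ 2) := by gcongr; exact h1.trans h3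
        _ = _ := by ring
    · intro s hs
      have hs' := mem_Icc.mp hs
      refine hΔ.card_divisors_le _ (by have := hs'.1; positivity) ?_
      calc 16 * s ^ 2 ≤ 16 * (4 * r) ^ 2 := by gcongr; omega
        _ = 256 * r ^ 2 := by ring
        _ ≤ 2400 * r ^ 4 := by gcongr <;> omega
    · refine hΔ.card_divisors_le _ (by positivity) ?_
      have h1 : c.natAbs ≤ 580 * N ^ 4 :=
        (Nat.le_mul_of_pos_right _ (by positivity)).trans hle
      calc 4 * c.natAbs ≤ 4 * (580 * r ^ 4) := by
            refine Nat.mul_le_mul_left 4 (h1.trans ?_)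
            gcongr
        _ ≤ _ := by omega
    · have := hΔ.log_le (4 * (4 * N / a)) (by positivity) (by omega)
      push_cast at this
      exact_mod_cast this
    · intro x hx
      have h1 := hmem x (mem_filter.mp hx).1
      exact ⟨h1.2.2.2.1, h1.2.2.2.2.1, h1.2.2.2.2.2, hfc x hx⟩
  rw [card_eq_sum_card_fiberwise hmaps]
  push_cast
  refine (sum_le_sum hfib).trans ?_
  rw [sum_const, nsmul_eq_mul]
  have hcard : (#((Icc (-(Q : ℤ)) Q).erase 0) : ℝ) = 2 * Q := by
    rw [card_erase_of_mem (by simp), Int.card_Icc]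
    have : ((Q : ℤ) + 1 - -(Q : ℤ)).toNat - 1 = 2 * Q := by omega
    rw [this]; push_cast; ring
  rw [hcard]
  calc 2 * (Q : ℝ) * (10 * Δ ^ 3 * N) ≤ 2 * (580 * (N : ℝ) ^ 4 / (a ^ 2 * r)) * (10 * Δ ^ 3 * N) := by
        gcongr
    _ = _ := by field_simp; ring

/-! ### Pairs of modular square roots sharing a difference. -/

theorem card_le_mul_card_of_fibers {ι κ : Type*} [DecidableEq κ] {S : Finset ι} {T : Finset κ}
    (f : ι → κ) {b : ℝ} (hf : ∀ x ∈ S, f x ∈ T) (hb : ∀ y ∈ T, (#{x ∈ S | f x = y} : ℝ) ≤ b) :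
    (#S : ℝ) ≤ #T * b := by
  rw [card_eq_sum_card_fiberwise hf]
  push_cast
  rw [← nsmul_eq_mul]
  exact sum_le_card_nsmul _ _ _ hb

/-- Modular square roots `k` of `J m` modulo `r`, for `1 ≤ m ≤ N` coprime to `r`. -/
def rootPairs (r : ℕ) [NeZero r] (J : (ZMod r)ˣ) (N : ℕ) : Finset (ZMod r × ℕ) :=
  {x ∈ univ ×ˢ Icc 1 N | x.2.Coprime r ∧ x.1 ^ 2 = J * x.2}

/-- Pairs of modular square roots belonging to distinct `m`. -/
def offPairs (r : ℕ) [NeZero r] (J : (ZMod r)ˣ) (N : ℕ) :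
    Finset ((ZMod r × ℕ) × (ZMod r × ℕ)) :=
  {p ∈ rootPairs r J N ×ˢ rootPairs r J N | p.1.2 ≠ p.2.2}

/-- Pairs of modular square roots with difference `h` belonging to distinct `m`. -/
def diffPairs (r : ℕ) [NeZero r] (J : (ZMod r)ˣ) (N : ℕ) (h : ZMod r) :
    Finset ((ZMod r × ℕ) × (ZMod r × ℕ)) :=
  {p ∈ offPairs r J N | p.2.1 - p.1.1 = h}

section

variable {r : ℕ} [NeZero r] {J : (ZMod r)ˣ} {N : ℕ}

theorem mem_rootPairs {x : ZMod r × ℕ} :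
    x ∈ rootPairs r J N ↔ (1 ≤ x.2 ∧ x.2 ≤ N) ∧ x.2.Coprime r ∧ x.1 ^ 2 = J * x.2 := by
  simp [rootPairs]

theorem mem_diffPairs {h : ZMod r} {p : (ZMod r × ℕ) × (ZMod r × ℕ)} :
    p ∈ diffPairs r J N h ↔ p.1 ∈ rootPairs r J N ∧ p.2 ∈ rootPairs r J N ∧
      p.1.2 ≠ p.2.2 ∧ p.2.1 - p.1.1 = h := by
  simp [diffPairs, offPairs, and_assoc]

/-- The root count over a full period: as `J m` is a unit, `γ² ∣ 4 a` and `γ² ∣ r` force `γ ∣ 2`. -/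
theorem card_sqrt_coprime_le {Δ : ℝ} (hΔ : DominatesDivisors Δ r) {m : ℕ} (hm : m.Coprime r) :
    (#{k : ZMod r | k ^ 2 = J * m} : ℝ) ≤ 3 * Δ := by
  have hr : 0 < r := NeZero.pos r
  have hinj : Set.InjOn (fun k : ZMod r => (k.val : ℤ))
      ({k : ZMod r | k ^ 2 = J * m} : Finset (ZMod r)) := by
    intro x _ y _ h
    exact ZMod.val_injective r (Int.natCast_inj.mp h)
  rw [← card_image_of_injOn hinj]
  set u : (ZMod r)ˣ := J * ZMod.unitOfCoprime m hm with hu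
  have huv : (u : ZMod r) = J * m := by simp [hu]
  set a : ℕ := (u : ZMod r).val with ha
  have haco : a.Coprime r := ZMod.val_coe_unit_coprime u
  have hmain := card_modular_roots_le (q := r) (a := a) (G := 2) (Λ := r) hr ?_
    (S := ({k : ZMod r | k ^ 2 = J * m} : Finset (ZMod r)).image (fun k => (k.val : ℤ))) ?_ ?_
  · refine hmain.trans ?_
    have h1 : (#r.divisors : ℝ) ≤ Δ := by
      refine hΔ.card_divisors_le r hr ?_
      have := Nat.le_self_pow (n := 4) (by norm_num) r
      omega
    have h2 : (r : ℝ) ≠ 0 := by exact_mod_cast hr.ne'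
    have h3 : (1 : ℝ) + r * (2 : ℕ) / r = 3 := by field_simp; norm_num
    rw [h3]
    linarith
  · intro γ h1 h2
    have h3 : γ ^ 2 ∣ 4 * a := by exact_mod_cast h2
    have h4 : (γ ^ 2).Coprime a := (haco.coprime_dvd_right h1).symm
    have h5 : γ ^ 2 ∣ 2 ^ 2 := h4.dvd_of_dvd_mul_right h3
    exact Nat.le_of_dvd (by norm_num) ((Nat.pow_dvd_pow_iff two_ne_zero).mp h5)
  · intro B hB
    obtain ⟨k, hk, rfl⟩ := mem_image.mp hB
    rw [← ZMod.intCast_zmod_eq_zero_iff_dvd]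
    have := (mem_filter.mp hk).2
    push_cast
    rw [ZMod.natCast_zmod_val, this, ha, ZMod.natCast_zmod_val, huv, sub_self]
  · intro x hx y hy
    obtain ⟨k, hk, rfl⟩ := mem_image.mp hx
    obtain ⟨k', hk', rfl⟩ := mem_image.mp hy
    have := ZMod.val_lt k'
    omega

theorem mul_sub_eq_of_mem_diffPairs {h : ZMod r} {p : (ZMod r × ℕ) × (ZMod r × ℕ)}
    (hp : p ∈ diffPairs r J N h) :
    (J : ZMod r) * ((p.2.2 : ZMod r) - p.1.2) = h * (p.1.1 + p.2.1) ∧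
    h ^ 2 + (p.1.1 + p.2.1) ^ 2 = 2 * J * ((p.1.2 : ZMod r) + p.2.2) := by
  obtain ⟨h1, h2, -, rfl⟩ := mem_diffPairs.mp hp
  have e1 := (mem_rootPairs.mp h1).2.2
  have e2 := (mem_rootPairs.mp h2).2.2
  constructor
  · linear_combination e1 - e2
  · linear_combination 2 * e1 + 2 * e2

/-- Eliminating `k₁ + k₂` from the two preceding relations leaves a condition on `m₁`, `m₂` and `c =
h² / J` alone; for fixed `h` it is linear in `n²` and `σ`. -/
theorem sq_sub_eq_of_mem_diffPairs {h : ZMod r} {p : (ZMod r × ℕ) × (ZMod r × ℕ)}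
    (hp : p ∈ diffPairs r J N h) :
    ((p.2.2 : ZMod r) - p.1.2) ^ 2 = 2 * (↑J⁻¹ * h ^ 2) * ((p.1.2 : ZMod r) + p.2.2) -
      (↑J⁻¹ * h ^ 2) ^ 2 := by
  obtain ⟨e1, e2⟩ := mul_sub_eq_of_mem_diffPairs hp
  have hJ : (↑J⁻¹ : ZMod r) * J = 1 := Units.inv_mul J
  set i : ZMod r := ↑J⁻¹
  set n : ZMod r := (p.2.2 : ZMod r) - p.1.2
  set s : ZMod r := (p.1.2 : ZMod r) + p.2.2
  have h1 : n = i * (J * n) := by rw [← mul_assoc, hJ, one_mul]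
  have h2 : s * 2 = i * (2 * J * s) := by linear_combination (-2 * s) * hJ
  rw [h1, e1, show 2 * (i * h ^ 2) * s = (i * h ^ 2) * (s * 2) by ring, h2, ← e2]
  ring

theorem cast_eq_zero_iff_dvd_of_castHom {d : ℕ} (hd : d ∣ r) (x : ZMod r) :
    ZMod.castHom hd (ZMod d) x = 0 ↔ d ∣ x.val := by
  rw [← ZMod.natCast_eq_zero_iff, ZMod.castHom_apply, ZMod.natCast_val]

theorem gcd_dvd_sub_of_mem_diffPairs {h : ZMod r} {p : (ZMod r × ℕ) × (ZMod r × ℕ)}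
    (hp : p ∈ diffPairs r J N h) : ((h.val.gcd r : ℕ) : ℤ) ∣ (p.2.2 : ℤ) - p.1.2 := by
  set d := h.val.gcd r
  have hd : d ∣ r := Nat.gcd_dvd_right _ _
  have e1 := congrArg (ZMod.castHom hd (ZMod d)) (mul_sub_eq_of_mem_diffPairs hp).1
  rw [map_mul, map_mul, (cast_eq_zero_iff_dvd_of_castHom hd h).mpr (Nat.gcd_dvd_left _ _),
    zero_mul] at e1
  have hu : IsUnit (ZMod.castHom hd (ZMod d) (J : ZMod r)) := J.isUnit.map _
  have e2 := (hu.mul_right_eq_zero).mp e1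
  rw [map_sub, map_natCast, map_natCast] at e2
  rw [← ZMod.intCast_zmod_eq_zero_iff_dvd]
  push_cast
  exact e2

/-- Equal `n` gives `h G = 0`, where `G` is the difference of the two root sums; hence `r / gcd (h,
r)` divides `G`. Since `G` is a factor of the difference of the squared root sums, it passes to the
difference of the `2 σ`. -/
theorem dvd_two_mul_sub_of_mem_diffPairs {h : ZMod r} {p q : (ZMod r × ℕ) × (ZMod r × ℕ)}
    (hp : p ∈ diffPairs r J N h) (hq : q ∈ diffPairs r J N h)
    (hpq : (p.2.2 : ℤ) - p.1.2 = (q.2.2 : ℤ) - q.1.2) :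
    ((r / h.val.gcd r : ℕ) : ℤ) ∣
      2 * ((p.1.2 : ℤ) + p.2.2) - 2 * ((q.1.2 : ℤ) + q.2.2) := by
  set d := h.val.gcd r with hd
  have hdr : d ∣ r := Nat.gcd_dvd_right _ _
  have hd0 : 0 < d := Nat.gcd_pos_of_pos_right _ (NeZero.pos r)
  have hRr : r / d ∣ r := Nat.div_dvd_of_dvd hdr
  obtain ⟨e1, e2⟩ := mul_sub_eq_of_mem_diffPairs hp
  obtain ⟨f1, f2⟩ := mul_sub_eq_of_mem_diffPairs hq
  have hpq' : (p.2.2 : ZMod r) - p.1.2 = (q.2.2 : ZMod r) - q.1.2 := by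
    have := congrArg (Int.cast : ℤ → ZMod r) hpq
    push_cast at this
    exact this
  have h1 : h * ((p.1.1 + p.2.1) - (q.1.1 + q.2.1)) = 0 := by
    rw [mul_sub, ← e1, ← f1, hpq', sub_self]
  set G := (p.1.1 + p.2.1) - (q.1.1 + q.2.1) with hG
  have h2 : r / d ∣ G.val := by
    have h3 : r ∣ h.val * G.val := by
      rw [← ZMod.natCast_eq_zero_iff]
      push_cast
      rw [ZMod.natCast_zmod_val, ZMod.natCast_zmod_val, h1]
    have h4 : d * (r / d) ∣ d * (h.val / d * G.val) := by
      rw [Nat.mul_div_cancel' hdr, ← mul_assoc, Nat.mul_div_cancel' (Nat.gcd_dvd_left _ _)]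
      exact h3
    have h5 := Nat.dvd_of_mul_dvd_mul_left hd0 h4
    exact (Nat.coprime_div_gcd_div_gcd hd0).symm.dvd_of_dvd_mul_left h5
  have h6 := (cast_eq_zero_iff_dvd_of_castHom hRr G).mpr h2
  have h7 : (J : ZMod r) * ((2 * ((p.1.2 : ℤ) + p.2.2) - 2 * ((q.1.2 : ℤ) + q.2.2) : ℤ) : ZMod r) =
      G * ((p.1.1 + p.2.1) + (q.1.1 + q.2.1)) := by
    push_cast
    linear_combination f2 - e2
  have h8 := congrArg (ZMod.castHom hRr (ZMod (r / d))) h7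
  rw [map_mul, map_mul, h6, zero_mul, map_intCast] at h8
  have hu : IsUnit (ZMod.castHom hRr (ZMod (r / d)) (J : ZMod r)) := J.isUnit.map _
  rw [← ZMod.intCast_zmod_eq_zero_iff_dvd]
  exact (hu.mul_right_eq_zero).mp h8

theorem card_diffPairs_fiber_le {Δ : ℝ} (hΔ : DominatesDivisors Δ r) (h : ZMod r) (m₁ m₂ : ℕ) :
    (#{p ∈ diffPairs r J N h | p.1.2 = m₁ ∧ p.2.2 = m₂} : ℝ) ≤ 3 * Δ := by
  rcases ({p ∈ diffPairs r J N h | p.1.2 = m₁ ∧ p.2.2 = m₂}).eq_empty_or_nonempty with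
    he | ⟨p₀, hp₀⟩
  · rw [he]
    have := hΔ.one_le
    simp only [card_empty, Nat.cast_zero]
    linarith
  obtain ⟨hp₀', rfl, rfl⟩ := mem_filter.mp hp₀
  have hco := (mem_rootPairs.mp (mem_diffPairs.mp hp₀').1).2.1
  refine le_trans ?_ (card_sqrt_coprime_le (J := J) hΔ hco)
  norm_cast
  refine card_le_card_of_injOn (fun p => p.1.1) ?_ ?_
  · intro p hp
    obtain ⟨hp, h1, -⟩ := mem_filter.mp hp
    simp only [coe_filter, mem_univ, true_and, Set.mem_ofPred_eq]
    rw [← h1]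
    exact (mem_rootPairs.mp (mem_diffPairs.mp hp).1).2.2
  · rintro ⟨⟨k₁, a₁⟩, ⟨k₂, a₂⟩⟩ hp ⟨⟨k₁', a₁'⟩, ⟨k₂', a₂'⟩⟩ hq hk
    obtain ⟨hp, h1, h2⟩ := mem_filter.mp hp
    obtain ⟨hq, h1', h2'⟩ := mem_filter.mp hq
    have e1 := (mem_diffPairs.mp hp).2.2.2
    have e2 := (mem_diffPairs.mp hq).2.2.2
    simp only at hk h1 h2 h1' h2' e1 e2
    subst hk
    have : k₂ = k₂' := by linear_combination e1 - e2
    simp [h1, h2, h1', h2', this]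

/-- With `d = gcd (h, r)` and `R = r / d`, there are at most `2 N / d` values of `n`, all multiples
of `d`. For each, `2 σ` lies in one class modulo `R ≤ 4 N`, which leaves at most `8 N / R` values.
The product is `O(N² / r)` since `d R = r`. -/
theorem card_diffPairs_le_of_div_gcd_le {Δ : ℝ} (hΔ : DominatesDivisors Δ r) (h : ZMod r)
    (hR : r / h.val.gcd r ≤ 4 * N) :
    (#(diffPairs r J N h) : ℝ) ≤ 48 * Δ * (N : ℝ) ^ 2 / r := by
  set d := h.val.gcd r with hd
  set R := r / d with hRdef
  have hdr : d ∣ r := Nat.gcd_dvd_right _ _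
  have hd0 : 0 < d := Nat.gcd_pos_of_pos_right _ (NeZero.pos r)
  have hR0 : 0 < R := Nat.div_pos (Nat.le_of_dvd (NeZero.pos r) hdr) hd0
  have hdR : (d : ℝ) * R = r := by exact_mod_cast Nat.mul_div_cancel' hdr
  have hd0' : (0 : ℝ) < d := by exact_mod_cast hd0
  have hR0' : (0 : ℝ) < R := by exact_mod_cast hR0
  set I := (diffPairs r J N h).image (fun p => (p.1.2, p.2.2)) with hI
  have h1 : (#(diffPairs r J N h) : ℝ) ≤ #I * (3 * Δ) := by
    refine card_le_mul_card_of_fibers (fun p => (p.1.2, p.2.2))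
      (fun x hx => mem_image_of_mem _ hx) ?_
    rintro ⟨m₁, m₂⟩ _
    simpa only [Prod.mk.injEq] using card_diffPairs_fiber_le hΔ h m₁ m₂
  set Q := (Icc (-((N / d : ℕ) : ℤ)) (N / d : ℕ)).erase 0 with hQ
  have hmemI : ∀ x ∈ I, (1 ≤ x.1 ∧ x.1 ≤ N) ∧ (1 ≤ x.2 ∧ x.2 ≤ N) ∧ x.1 ≠ x.2 ∧
      (d : ℤ) ∣ (x.2 : ℤ) - x.1 := by
    intro x hx
    obtain ⟨p, hp, rfl⟩ := mem_image.mp hx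
    obtain ⟨ha, hb, hc, -⟩ := mem_diffPairs.mp hp
    exact ⟨(mem_rootPairs.mp ha).1, (mem_rootPairs.mp hb).1, hc, gcd_dvd_sub_of_mem_diffPairs hp⟩
  have hmaps : ∀ x ∈ I, ((x.2 : ℤ) - x.1) / d ∈ Q := by
    intro x hx
    obtain ⟨ha, hb, hc, t, ht⟩ := hmemI x hx
    have hdZ : (d : ℤ) ≠ 0 := by exact_mod_cast hd0.ne'
    rw [ht, Int.mul_ediv_cancel_left _ hdZ, hQ, mem_erase, mem_Icc, ← abs_le]
    refine ⟨fun h0 => hc ?_, ?_⟩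
    · rw [h0, mul_zero] at ht; omega
    · rw [Int.abs_eq_natAbs]
      norm_cast
      rw [Nat.le_div_iff_mul_le hd0]
      have h2 : ((x.2 : ℤ) - x.1).natAbs = d * t.natAbs := by
        rw [ht, Int.natAbs_mul, Int.natAbs_natCast]
      rw [mul_comm, ← h2]
      omega
  have hfib : ∀ y ∈ Q, (#{x ∈ I | ((x.2 : ℤ) - x.1) / d = y} : ℝ) ≤ 8 * N / R := by
    intro y _
    have hn : ∀ x ∈ ({x ∈ I | ((x.2 : ℤ) - x.1) / d = y}), (x.2 : ℤ) - x.1 = y * d := by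
      intro x hx
      obtain ⟨hxI, hxy⟩ := mem_filter.mp hx
      rw [← hxy, Int.ediv_mul_cancel (hmemI x hxI).2.2.2]
    have hinj : Set.InjOn (fun x : ℕ × ℕ => 2 * ((x.1 : ℤ) + x.2))
        ({x ∈ I | ((x.2 : ℤ) - x.1) / d = y} : Finset _) := by
      intro x hx x' hx' he
      have ha := hn x hx
      have hb := hn x' hx'
      simp only at he
      ext <;> omega
    rw [← card_image_of_injOn hinj]
    have hc := card_le_of_dvd_sub (S := ({x ∈ I | ((x.2 : ℤ) - x.1) / d = y}).image
      (fun x : ℕ × ℕ => 2 * ((x.1 : ℤ) + x.2))) (Λ := 4 * N) hR0 ?_ ?_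
    · refine le_trans (b := (((4 * N) / R + 1 : ℕ) : ℝ)) (by exact_mod_cast hc) ?_
      have h3 : ((4 * N / R : ℕ) : ℝ) ≤ 4 * N / R := Nat.cast_div_le.trans (by push_cast; rfl)
      have h4 : (1 : ℝ) ≤ 4 * N / R := by
        rw [one_le_div hR0']
        exact_mod_cast hR
      push_cast
      calc _ ≤ (4 * N / R : ℝ) + 4 * N / R := by gcongr
        _ = _ := by ring
    · intro x hx x' hx'
      obtain ⟨w, hw, rfl⟩ := mem_image.mp hx
      obtain ⟨w', hw', rfl⟩ := mem_image.mp hx'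
      have ha := hn w hw
      have hb := hn w' hw'
      obtain ⟨p, hp, rfl⟩ := mem_image.mp (mem_filter.mp hw).1
      obtain ⟨p', hp', rfl⟩ := mem_image.mp (mem_filter.mp hw').1
      exact dvd_two_mul_sub_of_mem_diffPairs hp' hp (hb.trans ha.symm)
    · intro x hx x' hx'
      obtain ⟨w, hw, rfl⟩ := mem_image.mp hx
      obtain ⟨w', hw', rfl⟩ := mem_image.mp hx'
      have ha := hmemI w (mem_filter.mp hw).1
      have hb := hmemI w' (mem_filter.mp hw').1
      omega
  have h2 := card_le_mul_card_of_fibers _ hmaps hfib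
  have hQc : (#Q : ℝ) ≤ 2 * ((N : ℝ) / d) := by
    have h3 : #Q = 2 * (N / d) := by
      rw [hQ, card_erase_of_mem (mem_Icc.mpr ⟨neg_nonpos.mpr (Int.natCast_nonneg _),
        Int.natCast_nonneg _⟩), Int.card_Icc]
      omega
    rw [h3]
    push_cast
    gcongr
    exact Nat.cast_div_le
  have hΔ1 := hΔ.one_le
  calc (#(diffPairs r J N h) : ℝ) ≤ #I * (3 * Δ) := h1
    _ ≤ (#Q * (8 * N / R)) * (3 * Δ) := by gcongr
    _ ≤ (2 * (N / d : ℝ) * (8 * N / R)) * (3 * Δ) := by gcongr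
    _ = 48 * Δ * (N : ℝ) ^ 2 / (d * R) := by field_simp; ring
    _ = _ := by rw [hdR]

/-- Once `r / gcd (h, r)` exceeds the range of `2 σ`, the congruence for `2 σ` is an equality, so
`n` determines `(m₁, m₂)`. -/
theorem card_diffPairs_sub_eq_le {Δ : ℝ} (hΔ : DominatesDivisors Δ r) {h : ZMod r}
    (hR : 4 * N < r / h.val.gcd r) (n : ℤ) :
    (#{p ∈ diffPairs r J N h | (p.2.2 : ℤ) - p.1.2 = n} : ℝ) ≤ 3 * Δ := by
  rcases ({p ∈ diffPairs r J N h | (p.2.2 : ℤ) - p.1.2 = n}).eq_empty_or_nonempty with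
    he | ⟨p₀, hp₀⟩
  · rw [he]
    have := hΔ.one_le
    simp only [card_empty, Nat.cast_zero]
    linarith
  refine le_trans ?_ (card_diffPairs_fiber_le (J := J) (N := N) hΔ h p₀.1.2 p₀.2.2)
  refine Nat.cast_le.mpr (card_le_card fun p hp => ?_)
  obtain ⟨hp, hn⟩ := mem_filter.mp hp
  obtain ⟨hp₀, hn₀⟩ := mem_filter.mp hp₀
  have h1 := dvd_two_mul_sub_of_mem_diffPairs hp hp₀ (hn.trans hn₀.symm)
  have b1 := (mem_rootPairs.mp (mem_diffPairs.mp hp).1).1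
  have b2 := (mem_rootPairs.mp (mem_diffPairs.mp hp).2.1).1
  have b3 := (mem_rootPairs.mp (mem_diffPairs.mp hp₀).1).1
  have b4 := (mem_rootPairs.mp (mem_diffPairs.mp hp₀).2.1).1
  have h2 := Int.eq_zero_of_abs_lt_dvd h1 (by
    rw [abs_lt]
    have h3 := Nat.cast_lt (α := ℤ).mpr hR
    rw [Nat.cast_mul, Nat.cast_ofNat] at h3
    constructor <;> linarith [Nat.cast_le (α := ℤ).mpr b1.1, Nat.cast_le (α := ℤ).mpr b1.2,
      Nat.cast_le (α := ℤ).mpr b2.1, Nat.cast_le (α := ℤ).mpr b2.2,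
      Nat.cast_le (α := ℤ).mpr b3.1, Nat.cast_le (α := ℤ).mpr b3.2,
      Nat.cast_le (α := ℤ).mpr b4.1, Nat.cast_le (α := ℤ).mpr b4.2])
  exact mem_filter.mpr ⟨hp, by omega, by omega⟩

end

/-! ### Popular differences and short lattice vectors. -/

section

variable {r : ℕ} [NeZero r] {J : (ZMod r)ˣ} {N : ℕ}

/-- Factor `A = (n₁ - n₂)(n₁ + n₂)`: the first factor has at most `2 Δ` values and fixes the second,
and each `n` comes from at most `3 Δ` pairs. -/
theorem card_prod_diffPairs_sq_sub_eq_le {Δ : ℝ} (hΔ : DominatesDivisors Δ r) (hNr : N ≤ r)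
    {h : ZMod r} (hR : 4 * N < r / h.val.gcd r) {A : ℤ} (hA : A ≠ 0) (hAN : A.natAbs ≤ N ^ 2) :
    (#{w ∈ diffPairs r J N h ×ˢ diffPairs r J N h |
      ((w.1.2.2 : ℤ) - w.1.1.2) ^ 2 - ((w.2.2.2 : ℤ) - w.2.1.2) ^ 2 = A} : ℝ) ≤ 18 * Δ ^ 3 := by
  have hΔ1 := hΔ.one_le
  set T := diffPairs r J N h
  set n : (ZMod r × ℕ) × (ZMod r × ℕ) → ℤ := fun p => (p.2.2 : ℤ) - p.1.2 with hn
  set W := {w ∈ T ×ˢ T | n w.1 ^ 2 - n w.2 ^ 2 = A} with hW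
  change (#W : ℝ) ≤ _
  set D : Finset ℤ := A.natAbs.divisors.image (fun d : ℕ => (d : ℤ)) ∪
    A.natAbs.divisors.image (fun d : ℕ => -(d : ℤ)) with hD
  have hmaps : ∀ w ∈ W, n w.1 - n w.2 ∈ D := by
    intro w hw
    have h1 := (mem_filter.mp hw).2
    have h2 : (n w.1 - n w.2) ∣ A := ⟨n w.1 + n w.2, by rw [← h1]; ring⟩
    have h3 : (n w.1 - n w.2).natAbs ∈ A.natAbs.divisors :=
      Nat.mem_divisors.mpr ⟨Int.natAbs_dvd_natAbs.mpr h2, Int.natAbs_ne_zero.mpr hA⟩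
    rw [hD, mem_union, mem_image, mem_image]
    rcases Int.natAbs_eq (n w.1 - n w.2) with h4 | h4
    · exact Or.inl ⟨_, h3, h4.symm⟩
    · exact Or.inr ⟨_, h3, h4.symm⟩
  have hDc : (#D : ℝ) ≤ 2 * Δ := by
    have h1 : (#A.natAbs.divisors : ℝ) ≤ Δ := by
      refine hΔ.card_divisors_le _ (Int.natAbs_pos.mpr hA) (hAN.trans ?_)
      have hr : 1 ≤ r := NeZero.pos r
      calc N ^ 2 ≤ r ^ 2 := by gcongr
        _ ≤ r ^ 4 := Nat.pow_le_pow_right hr (by norm_num)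
        _ ≤ _ := by omega
    have h2 : #D ≤ #A.natAbs.divisors + #A.natAbs.divisors :=
      (card_union_le _ _).trans (add_le_add card_image_le card_image_le)
    have h3 : (#D : ℝ) ≤ #A.natAbs.divisors + #A.natAbs.divisors := by exact_mod_cast h2
    linarith
  have hfib : ∀ e ∈ D, (#{w ∈ W | n w.1 - n w.2 = e} : ℝ) ≤ 9 * Δ ^ 2 := by
    intro e _
    rcases ({w ∈ W | n w.1 - n w.2 = e}).eq_empty_or_nonempty with he | ⟨w₀, hw₀⟩
    · rw [he]; simp; positivity
    obtain ⟨hw₀W, he₀⟩ := mem_filter.mp hw₀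
    have h1 := (mem_filter.mp hw₀W).2
    have he0 : e ≠ 0 := by
      rintro rfl
      apply hA
      rw [← h1]
      linear_combination (n w₀.1 + n w₀.2) * he₀
    have hsub : {w ∈ W | n w.1 - n w.2 = e} ⊆
        {p ∈ T | n p = n w₀.1} ×ˢ {p ∈ T | n p = n w₀.2} := by
      intro w hw
      obtain ⟨hwW, hwe⟩ := mem_filter.mp hw
      obtain ⟨hwT, h2⟩ := mem_filter.mp hwW
      obtain ⟨hwT1, hwT2⟩ := mem_product.mp hwT
      have h3 : n w.1 + n w.2 = n w₀.1 + n w₀.2 := by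
        apply mul_left_cancel₀ he0
        linear_combination h2 - h1 - (n w.1 + n w.2) * hwe + (n w₀.1 + n w₀.2) * he₀
      refine mem_product.mpr ⟨mem_filter.mpr ⟨hwT1, by linarith⟩,
        mem_filter.mpr ⟨hwT2, by linarith⟩⟩
    have h4 := card_le_card hsub
    rw [card_product] at h4
    calc _ ≤ ((#{p ∈ T | n p = n w₀.1} * #{p ∈ T | n p = n w₀.2} : ℕ) : ℝ) := by exact_mod_cast h4
      _ = (#{p ∈ T | n p = n w₀.1} : ℝ) * #{p ∈ T | n p = n w₀.2} := by push_cast; ring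
      _ ≤ (3 * Δ) * (3 * Δ) := by
          gcongr
          · exact card_diffPairs_sub_eq_le hΔ hR _
          · exact card_diffPairs_sub_eq_le hΔ hR _
      _ = _ := by ring
  calc (#W : ℝ) ≤ #D * (9 * Δ ^ 2) := card_le_mul_card_of_fibers _ hmaps hfib
    _ ≤ 2 * Δ * (9 * Δ ^ 2) := by gcongr
    _ = _ := by ring

/-- If many pairs of roots share the difference `h`, then the lattice
`A ≡ 2 (h² / J) s mod r` contains a short vector. -/
theorem exists_short_vector {Δ : ℝ} (hΔ : DominatesDivisors Δ r) (hNr : N ≤ r)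
    {h : ZMod r} (hR : 4 * N < r / h.val.gcd r) {a : ℕ} (ha : 0 < a)
    (hT : 12 * Δ ^ 2 * a ≤ #(diffPairs r J N h)) (har : 2 * N ^ 2 < r * a) :
    ∃ A : ℤ, ∃ s : ℕ, 0 < s ∧ s * a ≤ 4 * N ∧ |A| * a ≤ 2 * N ^ 2 ∧
      (A : ZMod r) = 2 * (↑J⁻¹ * h ^ 2) * s := by
  have hΔ1 := hΔ.one_le
  set T := diffPairs r J N h with hTdef
  set n : (ZMod r × ℕ) × (ZMod r × ℕ) → ℤ := fun p => (p.2.2 : ℤ) - p.1.2 with hn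
  set σ : (ZMod r × ℕ) × (ZMod r × ℕ) → ℤ := fun p => (p.1.2 : ℤ) + p.2.2 with hσ
  have hbd : ∀ p ∈ T, n p ^ 2 ≤ N ^ 2 ∧ 0 ≤ σ p ∧ σ p ≤ 2 * N := by
    intro p hp
    have b1 := (mem_rootPairs.mp (mem_diffPairs.mp hp).1).1
    have b2 := (mem_rootPairs.mp (mem_diffPairs.mp hp).2.1).1
    refine ⟨?_, by positivity, by simp only [hσ]; omega⟩
    rw [sq_le_sq, abs_of_nonneg (by positivity : (0 : ℤ) ≤ N), abs_le]
    simp only [hn]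
    constructor <;> omega
  set P := {w ∈ T ×ˢ T | n w.1 ^ 2 - n w.2 ^ 2 ≠ 0} with hP
  -- The degenerate case `n₁ = ± n₂` accounts for at most `6 Δ #T ≤ #T² / 2` elements, so at least
  -- half of `T ×ˢ T` survives.
  have hPc : a ^ 2 * (18 * Δ ^ 3) < (#P : ℝ) := by
    have h1 : (#{w ∈ T ×ˢ T | n w.1 ^ 2 - n w.2 ^ 2 = 0} : ℝ) ≤ #T * (6 * Δ) := by
      refine card_le_mul_card_of_fibers (fun w => w.1)
        (fun w hw => (mem_product.mp (mem_filter.mp hw).1).1) ?_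
      intro p _
      have hinj : Set.InjOn
          (fun w : ((ZMod r × ℕ) × ZMod r × ℕ) × (ZMod r × ℕ) × ZMod r × ℕ => w.2)
          ↑({w ∈ {w ∈ T ×ˢ T | n w.1 ^ 2 - n w.2 ^ 2 = 0} | w.1 = p}) := by
        intro w hw w' hw' he
        exact Prod.ext ((mem_filter.mp hw).2.trans (mem_filter.mp hw').2.symm) he
      rw [← card_image_of_injOn hinj]
      have hsub : ({w ∈ {w ∈ T ×ˢ T | n w.1 ^ 2 - n w.2 ^ 2 = 0} | w.1 = p}).image
          (fun w => w.2) ⊆ {q ∈ T | n q = n p} ∪ {q ∈ T | n q = -n p} := by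
        intro q hq
        obtain ⟨w, hw, rfl⟩ := mem_image.mp hq
        obtain ⟨hw', rfl⟩ := mem_filter.mp hw
        obtain ⟨hw'', h0⟩ := mem_filter.mp hw'
        have hq := (mem_product.mp hw'').2
        rw [mem_union, mem_filter, mem_filter]
        rcases sq_eq_sq_iff_eq_or_eq_neg.mp (sub_eq_zero.mp h0).symm with h | h
        · exact Or.inl ⟨hq, h⟩
        · exact Or.inr ⟨hq, h⟩
      have h2 := (card_le_card hsub).trans (card_union_le _ _)
      have h3 := card_diffPairs_sub_eq_le (J := J) hΔ hR (n p)
      have h4 := card_diffPairs_sub_eq_le (J := J) hΔ hR (-n p)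
      calc _ ≤ ((#{q ∈ T | n q = n p} + #{q ∈ T | n q = -n p} : ℕ) : ℝ) := by exact_mod_cast h2
        _ = (#{q ∈ T | n q = n p} : ℝ) + #{q ∈ T | n q = -n p} := by push_cast; ring
        _ ≤ 3 * Δ + 3 * Δ := add_le_add h3 h4
        _ = _ := by ring
    have h2 := card_filter_add_card_filter_not (s := T ×ˢ T)
      (fun w => n w.1 ^ 2 - n w.2 ^ 2 = 0)
    rw [card_product] at h2
    have h3 : (#T : ℝ) * #T = #{w ∈ T ×ˢ T | n w.1 ^ 2 - n w.2 ^ 2 = 0} + #P := by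
      rw [hP]; exact_mod_cast h2.symm
    have ha1 : (1 : ℝ) ≤ a := by exact_mod_cast ha
    have h4 : 12 * Δ ≤ #T := by
      refine le_trans ?_ hT
      have : Δ ≤ Δ ^ 2 * a := by nlinarith
      linarith
    have h5 : (#T : ℝ) * #T ≤ 2 * #P := by nlinarith
    have h6 : (12 * Δ ^ 2 * a) * (12 * Δ ^ 2 * a) ≤ #T * #T := by gcongr
    have h7 : (a : ℝ) ^ 2 * Δ ^ 3 ≤ a ^ 2 * Δ ^ 4 := by
      gcongr
      norm_num
    have h8 : 0 < (a : ℝ) ^ 2 * Δ ^ 4 := by positivity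
    nlinarith
  -- Cells of size `w₁ × w₂`: `a²` of them cover all values of `(n₁² - n₂², σ₁ - σ₂)`.
  set w₁ : ℤ := 2 * N ^ 2 / a + 1 with hw₁
  set w₂ : ℤ := 4 * N / a + 1 with hw₂
  have haZ : (0 : ℤ) < a := by exact_mod_cast ha
  have hw₁0 : 0 < w₁ := by positivity
  have hw₂0 : 0 < w₂ := by positivity
  have hcell₁ : (2 * N ^ 2 : ℤ) < a * w₁ := by
    have := Int.lt_mul_ediv_self_add (x := 2 * (N : ℤ) ^ 2) haZ
    rw [hw₁]; linarith
  have hcell₂ : (4 * N : ℤ) < a * w₂ := by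
    have := Int.lt_mul_ediv_self_add (x := 4 * (N : ℤ)) haZ
    rw [hw₂]; linarith
  have hmaps : ∀ w ∈ P, ((n w.1 ^ 2 - n w.2 ^ 2 + N ^ 2) / w₁, (σ w.1 - σ w.2 + 2 * N) / w₂) ∈
      Ico (0 : ℤ) a ×ˢ Ico (0 : ℤ) a := by
    intro w hw
    obtain ⟨hw1, hw2⟩ := mem_product.mp (mem_filter.mp hw).1
    have b1 := hbd _ hw1
    have b2 := hbd _ hw2
    rw [mem_product, mem_Ico, mem_Ico]
    refine ⟨⟨Int.ediv_nonneg ?_ hw₁0.le, Int.ediv_lt_of_lt_mul hw₁0 ?_⟩,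
      ⟨Int.ediv_nonneg ?_ hw₂0.le, Int.ediv_lt_of_lt_mul hw₂0 ?_⟩⟩
    · nlinarith [sq_nonneg (n w.1)]
    · nlinarith [sq_nonneg (n w.2)]
    · linarith
    · linarith
  obtain ⟨y, -, hy⟩ := exists_lt_card_fiber_of_nsmul_lt_card_of_maps_to (b := 18 * Δ ^ 3) hmaps (by
    rw [card_product, Int.card_Ico, nsmul_eq_mul]
    simp only [sub_zero, Int.toNat_natCast]
    push_cast
    calc _ = (a : ℝ) ^ 2 * (18 * Δ ^ 3) := by ring
      _ < _ := hPc)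
  set F := {w ∈ P | ((n w.1 ^ 2 - n w.2 ^ 2 + N ^ 2) / w₁, (σ w.1 - σ w.2 + 2 * N) / w₂) = y} with hF
  -- The cell holds more than `18 Δ³` elements, more than can share one nonzero value of `n₁² -
  -- n₂²`.
  have hexists : ∃ w ∈ F, ∃ w' ∈ F, n w.1 ^ 2 - n w.2 ^ 2 ≠ n w'.1 ^ 2 - n w'.2 ^ 2 := by
    by_contra! hcon
    rcases F.eq_empty_or_nonempty with he | ⟨w₀, hw₀⟩
    · rw [he] at hy
      simp only [card_empty, Nat.cast_zero] at hy
      have : 0 < Δ ^ 3 := by positivity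
      linarith
    obtain ⟨hTT, hne⟩ := mem_filter.mp (mem_filter.mp hw₀).1
    obtain ⟨hw1, hw2⟩ := mem_product.mp hTT
    have b1 := hbd _ hw1
    have b2 := hbd _ hw2
    have hle := card_prod_diffPairs_sq_sub_eq_le (J := J) hΔ hNr hR hne (by
      zify
      rw [abs_le]
      constructor <;> nlinarith [sq_nonneg (n w₀.1), sq_nonneg (n w₀.2)])
    refine absurd hy (not_lt.mpr (le_trans (Nat.cast_le.mpr (card_le_card fun w hw => ?_)) hle))
    exact mem_filter.mpr ⟨(mem_filter.mp (mem_filter.mp hw).1).1, hcon w hw w₀ hw₀⟩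
  obtain ⟨w, hw, w', hw', hne⟩ := hexists
  set A := (n w.1 ^ 2 - n w.2 ^ 2) - (n w'.1 ^ 2 - n w'.2 ^ 2) with hA
  set S := (σ w.1 - σ w.2) - (σ w'.1 - σ w'.2) with hS
  have hdiv : ∀ x y m q : ℤ, 0 < m → x / m = q → y / m = q → |x - y| < m := by
    intro x y m q hm hx hy
    have e1 := Int.emod_add_mul_ediv x m
    have e2 := Int.emod_add_mul_ediv y m
    have e3 := Int.emod_nonneg x hm.ne'
    have e4 := Int.emod_nonneg y hm.ne'
    have e5 := Int.emod_lt_of_pos x hm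
    have e6 := Int.emod_lt_of_pos y hm
    rw [hx] at e1
    rw [hy] at e2
    rw [abs_lt]
    constructor <;> linarith
  have hwy := (mem_filter.mp hw).2
  have hwy' := (mem_filter.mp hw').2
  rw [Prod.ext_iff] at hwy hwy'
  have hAlt : |A| < w₁ := by
    have := hdiv _ _ _ _ hw₁0 hwy.1 hwy'.1
    rwa [add_sub_add_right_eq_sub] at this
  have hSlt : |S| < w₂ := by
    have := hdiv _ _ _ _ hw₂0 hwy.2 hwy'.2
    rwa [add_sub_add_right_eq_sub] at this
  have hAle : |A| * a ≤ 2 * N ^ 2 := by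
    calc |A| * a ≤ 2 * N ^ 2 / a * a := by gcongr; omega
      _ ≤ _ := Int.ediv_mul_le _ haZ.ne'
  have hSle : |S| * a ≤ 4 * N := by
    calc |S| * a ≤ 4 * N / a * a := by gcongr; omega
      _ ≤ _ := Int.ediv_mul_le _ haZ.ne'
  have hcong : (A : ZMod r) = 2 * (↑J⁻¹ * h ^ 2) * (S : ZMod r) := by
    obtain ⟨hw1, hw2⟩ := mem_product.mp (mem_filter.mp (mem_filter.mp hw).1).1
    obtain ⟨hw1', hw2'⟩ := mem_product.mp (mem_filter.mp (mem_filter.mp hw').1).1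
    have e1 := sq_sub_eq_of_mem_diffPairs hw1
    have e2 := sq_sub_eq_of_mem_diffPairs hw2
    have e3 := sq_sub_eq_of_mem_diffPairs hw1'
    have e4 := sq_sub_eq_of_mem_diffPairs hw2'
    rw [hA, hS]
    simp only [hn, hσ]
    push_cast
    linear_combination e1 - e2 - e3 + e4
  have hA0 : A ≠ 0 := sub_ne_zero.mpr hne
  -- If `S = 0`, then `r ∣ A`, while `|A| ≤ 2 N² / a < r`; this contradicts `A ≠ 0`.
  have hS0 : S ≠ 0 := by
    intro h0
    rw [h0, Int.cast_zero, mul_zero, ZMod.intCast_zmod_eq_zero_iff_dvd] at hcong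
    apply hA0
    refine Int.eq_zero_of_abs_lt_dvd hcong ?_
    have h1 : (2 * N ^ 2 : ℤ) < r * a := by exact_mod_cast har
    exact lt_of_mul_lt_mul_right (hAle.trans_lt h1) haZ.le
  have hSa : S.natAbs * a ≤ 4 * N := by zify; exact hSle
  rcases Int.natAbs_eq S with hs | hs
  · refine ⟨A, S.natAbs, Int.natAbs_pos.mpr hS0, hSa, hAle, ?_⟩
    rw [hcong]
    conv_lhs => rw [hs]
    simp
  · refine ⟨-A, S.natAbs, Int.natAbs_pos.mpr hS0, hSa, by rwa [abs_neg], ?_⟩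
    rw [Int.cast_neg, hcong]
    conv_lhs => rw [hs]
    simp

/-- The product leaves at most `Δ` choices of `(m₁, m₂)`, each with at most `(3 Δ)²` choices of
roots. -/
theorem card_offPairs_mul_eq_le {Δ : ℝ} (hΔ : DominatesDivisors Δ r) (hNr : N ≤ r) {P : ℕ}
    (hP : 1 ≤ P) (hPN : P ≤ N ^ 2) :
    (#{p ∈ offPairs r J N | p.1.2 * p.2.2 = P} : ℝ) ≤ 9 * Δ ^ 3 := by
  have hΔ1 := hΔ.one_le
  have hr : 1 ≤ r := NeZero.pos r
  have h1 : (#P.divisors : ℝ) ≤ Δ := by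
    refine hΔ.card_divisors_le _ hP (hPN.trans ?_)
    calc N ^ 2 ≤ r ^ 2 := by gcongr
      _ ≤ r ^ 4 := Nat.pow_le_pow_right hr (by norm_num)
      _ ≤ _ := by omega
  have h2 := card_le_mul_card_of_fibers (S := {p ∈ offPairs r J N | p.1.2 * p.2.2 = P})
    (T := P.divisors) (b := 9 * Δ ^ 2) (fun p => p.1.2) ?_ ?_
  · calc _ ≤ (#P.divisors : ℝ) * (9 * Δ ^ 2) := h2
      _ ≤ Δ * (9 * Δ ^ 2) := by gcongr
      _ = _ := by ring
  · intro p hp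
    exact Nat.mem_divisors.mpr ⟨⟨_, (mem_filter.mp hp).2.symm⟩, by omega⟩
  · intro m hm
    rcases ({p ∈ {p ∈ offPairs r J N | p.1.2 * p.2.2 = P} | p.1.2 = m}).eq_empty_or_nonempty with
      he | ⟨p₀, hp₀⟩
    · rw [he]; simp; positivity
    obtain ⟨hp₀', hm₀⟩ := mem_filter.mp hp₀
    obtain ⟨hp₀'', hP₀⟩ := mem_filter.mp hp₀'
    obtain ⟨hx, hy⟩ := mem_product.mp (mem_filter.mp hp₀'').1
    have hc1 := card_sqrt_coprime_le (J := J) hΔ (mem_rootPairs.mp hx).2.1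
    have hc2 := card_sqrt_coprime_le (J := J) hΔ (mem_rootPairs.mp hy).2.1
    have hinj : #{p ∈ {p ∈ offPairs r J N | p.1.2 * p.2.2 = P} | p.1.2 = m} ≤
        #(({k : ZMod r | k ^ 2 = J * p₀.1.2} : Finset _) ×ˢ
          ({k : ZMod r | k ^ 2 = J * p₀.2.2} : Finset _)) := by
      have hm0 : 0 < m := Nat.pos_of_mem_divisors hm
      have hval : ∀ p ∈ ({p ∈ {p ∈ offPairs r J N | p.1.2 * p.2.2 = P} | p.1.2 = m}),
          p.1 ∈ rootPairs r J N ∧ p.2 ∈ rootPairs r J N ∧ p.1.2 = p₀.1.2 ∧ p.2.2 = p₀.2.2 := by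
        intro p hp
        obtain ⟨hp', hpm⟩ := mem_filter.mp hp
        obtain ⟨hp'', hpP⟩ := mem_filter.mp hp'
        obtain ⟨hx', hy'⟩ := mem_product.mp (mem_filter.mp hp'').1
        refine ⟨hx', hy', hpm.trans hm₀.symm, ?_⟩
        rw [hpm] at hpP
        rw [hm₀] at hP₀
        exact Nat.eq_of_mul_eq_mul_left hm0 (hpP.trans hP₀.symm)
      refine card_le_card_of_injOn (fun p => (p.1.1, p.2.1)) ?_ ?_
      · intro p hp
        obtain ⟨ha, hb, hc, hd⟩ := hval p hp
        have ha' := (mem_rootPairs.mp ha).2.2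
        have hb' := (mem_rootPairs.mp hb).2.2
        rw [hc] at ha'
        rw [hd] at hb'
        simp [ha', hb']
      · rintro ⟨⟨k, a⟩, ⟨k', a'⟩⟩ hp ⟨⟨l, b⟩, ⟨l', b'⟩⟩ hq he
        obtain ⟨-, -, ha, hb⟩ := hval _ hp
        obtain ⟨-, -, hc, hd⟩ := hval _ hq
        simp only [Prod.mk.injEq] at he ha hb hc hd ⊢
        exact ⟨⟨he.1, ha.trans hc.symm⟩, he.2, hb.trans hd.symm⟩
    rw [card_product] at hinj
    calc _ ≤ ((#{k : ZMod r | k ^ 2 = J * p₀.1.2} * #{k : ZMod r | k ^ 2 = J * p₀.2.2} : ℕ) : ℝ) := by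
          exact_mod_cast hinj
      _ = (#{k : ZMod r | k ^ 2 = J * p₀.1.2} : ℝ) * #{k : ZMod r | k ^ 2 = J * p₀.2.2} := by
          push_cast; ring
      _ ≤ (3 * Δ) * (3 * Δ) := by gcongr
      _ = _ := by ring

/-- Root pairs whose difference admits a short lattice vector inject, up to divisor multiplicity,
into the triples `(s, B, P)`. -/
theorem card_offPairs_le_card_quadTriples {Δ : ℝ} (hΔ : DominatesDivisors Δ r) (hNr : N ≤ r)
    {a : ℕ} (ha : 0 < a) {U : Finset ((ZMod r × ℕ) × (ZMod r × ℕ))} (hU : U ⊆ offPairs r J N)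
    (hvec : ∀ p ∈ U, ∃ A : ℤ, ∃ s : ℕ, 0 < s ∧ s * a ≤ 4 * N ∧ |A| * a ≤ 2 * N ^ 2 ∧
      (A : ZMod r) = 2 * (↑J⁻¹ * (p.2.1 - p.1.1) ^ 2) * s) :
    (#U : ℝ) ≤ #(quadTriples r N a) * (9 * Δ ^ 3) := by
  classical
  choose! A s hs0 hsa hAa hA using hvec
  refine card_le_mul_card_of_fibers (fun p => (s p, A p - 2 * s p * (p.1.2 + p.2.2),
    p.1.2 * p.2.2)) ?_ ?_
  · intro p hp
    have hpo := hU hp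
    obtain ⟨hx, hy⟩ := mem_product.mp (mem_filter.mp hpo).1
    obtain ⟨b1, -⟩ := mem_rootPairs.mp hx
    obtain ⟨b2, -⟩ := mem_rootPairs.mp hy
    have hs := hs0 p hp
    have hsa' := hsa p hp
    have hBa : |A p - 2 * s p * (p.1.2 + p.2.2)| * a ≤ 18 * (N : ℤ) ^ 2 := by
      have h1 : |A p - 2 * s p * (p.1.2 + p.2.2)| ≤ |A p| + 2 * s p * (p.1.2 + p.2.2) := by
        refine (abs_sub _ _).trans (le_of_eq ?_)
        rw [abs_of_nonneg (by positivity : (0 : ℤ) ≤ 2 * s p * (p.1.2 + p.2.2))]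
      have h2 : (s p : ℤ) * a ≤ 4 * N := by exact_mod_cast hsa'
      have h3 : ((p.1.2 : ℤ) + p.2.2) ≤ 2 * N := by omega
      calc _ ≤ (|A p| + 2 * s p * (p.1.2 + p.2.2)) * a := by gcongr
        _ = |A p| * a + 2 * (s p * a) * (p.1.2 + p.2.2) := by ring
        _ ≤ 2 * N ^ 2 + 2 * (4 * N) * (2 * N) := add_le_add (hAa p hp) (by gcongr)
        _ = _ := by ring
    rw [quadTriples, mem_filter, mem_product, mem_product, mem_Icc, mem_Icc, mem_Icc]
    refine ⟨⟨⟨hs, ?_⟩, ?_, ⟨Nat.mul_pos b1.1 b2.1, ?_⟩⟩, hsa', hBa, ?_⟩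
    · exact (Nat.le_mul_of_pos_right _ ha).trans hsa'
    · rw [← abs_le]
      refine le_trans ?_ hBa
      exact le_mul_of_one_le_right (abs_nonneg _) (by exact_mod_cast ha)
    · rw [sq]; exact Nat.mul_le_mul b1.2 b2.2
    · rw [← ZMod.intCast_zmod_eq_zero_iff_dvd]
      have hd : p ∈ diffPairs r J N (p.2.1 - p.1.1) := mem_filter.mpr ⟨hpo, rfl⟩
      have e1 := sq_sub_eq_of_mem_diffPairs hd
      have e2 := hA p hp
      push_cast
      set c : ZMod r := ↑J⁻¹ * (p.2.1 - p.1.1) ^ 2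
      rw [e2]
      -- With `A = 2 c s`, the expression equals `4 s² (n² - 2 c σ + c²)`, as `σ² - 4 m₁ m₂ = n²`.
      linear_combination 4 * (s p : ZMod r) ^ 2 * e1
  · rintro ⟨σ, B, P⟩ hy
    obtain ⟨h1, h2⟩ := mem_Icc.mp (mem_product.mp (mem_product.mp (mem_filter.mp hy).1).2).2
    refine le_trans (Nat.cast_le.mpr (card_le_card fun p hp => ?_))
      (card_offPairs_mul_eq_le (J := J) hΔ hNr h1 h2)
    obtain ⟨hp, he⟩ := mem_filter.mp hp
    simp only [Prod.mk.injEq] at he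
    exact mem_filter.mpr ⟨hU hp, he.2.2⟩

theorem card_rootPairs_le {Δ : ℝ} (hΔ : DominatesDivisors Δ r) :
    (#(rootPairs r J N) : ℝ) ≤ 3 * Δ * N := by
  have h := card_le_mul_card_of_fibers (S := rootPairs r J N) (T := Icc 1 N) (b := 3 * Δ)
    (fun x => x.2) (fun x hx => mem_Icc.mpr (mem_rootPairs.mp hx).1) ?_
  · rw [Nat.card_Icc, Nat.add_sub_cancel] at h
    linarith
  · intro m _
    rcases ({x ∈ rootPairs r J N | x.2 = m}).eq_empty_or_nonempty with he | ⟨x₀, hx₀⟩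
    · rw [he]
      have := hΔ.one_le
      simp only [card_empty, Nat.cast_zero]
      linarith
    obtain ⟨hx₀', rfl⟩ := mem_filter.mp hx₀
    refine le_trans ?_ (card_sqrt_coprime_le (J := J) hΔ (mem_rootPairs.mp hx₀').2.1)
    refine Nat.cast_le.mpr (card_le_card_of_injOn (fun x => x.1) ?_ ?_)
    · intro x hx
      obtain ⟨hx, he⟩ := mem_filter.mp hx
      have := (mem_rootPairs.mp hx).2.2
      rw [he] at this
      simpa using this
    · intro x hx y hy he
      exact Prod.ext he ((mem_filter.mp hx).2.trans (mem_filter.mp hy).2.symm)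

/-- Pairs of roots whose difference is attained at least `t` times. -/
theorem card_popular_offPairs_le {Δ : ℝ} (hΔ : DominatesDivisors Δ r) (hN : 1 ≤ N) (hNr : N ≤ r)
    {t : ℝ} (ht : 0 < t) :
    (#{p ∈ offPairs r J N | t ≤ #(diffPairs r J N (p.2.1 - p.1.1))} : ℝ) ≤
      1300000 * Δ ^ 8 * N ^ 2 * Real.sqrt (1 + N ^ 3 / r) / t := by
  have hΔ1 := hΔ.one_le
  have hr : 0 < r := NeZero.pos r
  have hrR : (0 : ℝ) < r := by exact_mod_cast hr
  have hNR : (1 : ℝ) ≤ N := by exact_mod_cast hN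
  have hNrR : (N : ℝ) ≤ r := by exact_mod_cast hNr
  set T₀ := Real.sqrt (1 + N ^ 3 / r) with hT₀
  have hq : (0 : ℝ) ≤ N ^ 3 / r := by positivity
  have hT₀1 : 1 ≤ T₀ := Real.one_le_sqrt.mpr (by linarith)
  have hT₀sq : T₀ ^ 2 = 1 + (N : ℝ) ^ 3 / r := Real.sq_sqrt (by positivity)
  have hNT : (N : ℝ) ^ 2 / r ≤ T₀ := by
    refine Real.le_sqrt_of_sq_le ?_
    have : ((N : ℝ) ^ 2 / r) ^ 2 = N ^ 3 / r * (N / r) := by field_simp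
    rw [this]
    have h1 : (N : ℝ) / r ≤ 1 := (div_le_one hrR).mpr hNrR
    nlinarith
  set U := {p ∈ offPairs r J N | t ≤ #(diffPairs r J N (p.2.1 - p.1.1))} with hU
  -- For small `t`, the trivial bound by all pairs of roots is enough.
  rcases le_or_gt t (48 * Δ ^ 2 * T₀) with hcase | hcase
  · have h1 : (#U : ℝ) ≤ (3 * Δ * N) * (3 * Δ * N) := by
      calc (#U : ℝ) ≤ (#(rootPairs r J N ×ˢ rootPairs r J N) : ℝ) :=
            Nat.cast_le.mpr (card_le_card ((filter_subset _ _).trans (filter_subset _ _)))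
        _ = (#(rootPairs r J N) : ℝ) * #(rootPairs r J N) := by rw [card_product]; push_cast; ring
        _ ≤ _ := by gcongr <;> exact card_rootPairs_le hΔ
    refine h1.trans ?_
    rw [le_div_iff₀ ht]
    have h2 : Δ ^ 4 ≤ Δ ^ 8 := pow_le_pow_right₀ hΔ1 (by norm_num)
    calc 3 * Δ * N * (3 * Δ * N) * t ≤ 3 * Δ * N * (3 * Δ * N) * (48 * Δ ^ 2 * T₀) := by gcongr
      _ = 432 * Δ ^ 4 * N ^ 2 * T₀ := by ring
      _ ≤ 1300000 * Δ ^ 8 * N ^ 2 * T₀ := by gcongr; norm_num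
  -- The largest `a` allowed by `exists_short_vector`. Since `t > 48 Δ² T₀` and `N² / r ≤ T₀`, it
  -- satisfies `a ≥ 1` and `2 N² < r a`.
  · set a := ⌊t / (12 * Δ ^ 2)⌋₊ with ha
    have hΔ2 : 0 < 12 * Δ ^ 2 := by positivity
    have h48 : 48 * Δ ^ 2 ≤ t := by
      refine le_trans ?_ hcase.le
      exact le_mul_of_one_le_right (by positivity) hT₀1
    have hx1 : 1 ≤ t / (12 * Δ ^ 2) := by
      rw [one_le_div hΔ2]; linarith
    have ha1 : 1 ≤ a := Nat.le_floor (by exact_mod_cast hx1)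
    have ha1R : (1 : ℝ) ≤ a := by exact_mod_cast ha1
    have ha0 : (0 : ℝ) < a := by linarith
    have hale : 12 * Δ ^ 2 * a ≤ t := by
      have := Nat.floor_le (show 0 ≤ t / (12 * Δ ^ 2) by positivity)
      rw [le_div_iff₀ hΔ2] at this
      linarith
    have hage : t ≤ 24 * Δ ^ 2 * a := by
      have := Nat.lt_floor_add_one (t / (12 * Δ ^ 2))
      rw [div_lt_iff₀ hΔ2] at this
      nlinarith
    have har : 2 * N ^ 2 < r * a := by
      have h1 : 2 * T₀ < a := by
        have : 48 * Δ ^ 2 * T₀ < 24 * Δ ^ 2 * a := hcase.trans_le hage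
        nlinarith
      have h2 : (N : ℝ) ^ 2 ≤ T₀ * r := (div_le_iff₀ hrR).mp hNT
      have h3 : (2 : ℝ) * N ^ 2 < r * a := by nlinarith
      exact_mod_cast h3
    have hmain := card_offPairs_le_card_quadTriples (J := J) hΔ hNr ha1 (U := U)
      (filter_subset _ _) ?_
    · have hcount := card_quadTriples_le hΔ hr hN hNr ha1
      have hinv : 1 / (a : ℝ) ≤ 24 * Δ ^ 2 / t := by
        rw [div_le_div_iff₀ ha0 ht]; linarith
      -- One factor `1 / t` is traded for `1 / T₀`, which brings `N⁵ / (a² r)` down to `N² T₀ / t`.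
      have hinv2 : 1 / (a : ℝ) ^ 2 ≤ 12 * Δ ^ 2 / (t * T₀) := by
        calc 1 / (a : ℝ) ^ 2 = (1 / a) * (1 / a) := by field_simp
          _ ≤ (24 * Δ ^ 2 / t) * (24 * Δ ^ 2 / t) := by gcongr
          _ ≤ (24 * Δ ^ 2 / t) * (24 * Δ ^ 2 / (48 * Δ ^ 2 * T₀)) := by gcongr
          _ = _ := by field_simp; ring
      have hN5 : (N : ℝ) ^ 5 / (a ^ 2 * r) ≤ 12 * Δ ^ 2 * N ^ 2 * T₀ / t := by
        calc (N : ℝ) ^ 5 / (a ^ 2 * r) = N ^ 2 * (N ^ 3 / r) * (1 / a ^ 2) := by field_simp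
          _ ≤ N ^ 2 * T₀ ^ 2 * (12 * Δ ^ 2 / (t * T₀)) := by
              gcongr
              linarith
          _ = _ := by field_simp
      have hN2 : 12 * (N : ℝ) ^ 2 / a ≤ 288 * Δ ^ 2 * N ^ 2 * T₀ / t := by
        calc 12 * (N : ℝ) ^ 2 / a = 12 * N ^ 2 * (1 / a) := by ring
          _ ≤ 12 * N ^ 2 * (24 * Δ ^ 2 / t) := by gcongr
          _ = 288 * Δ ^ 2 * N ^ 2 * 1 / t := by ring
          _ ≤ _ := by gcongr
      have hpow : Δ ^ 5 ≤ Δ ^ 8 := pow_le_pow_right₀ hΔ1 (by norm_num)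
      calc (#U : ℝ) ≤ #(quadTriples r N a) * (9 * Δ ^ 3) := hmain
        _ ≤ (288 * Δ ^ 2 * N ^ 2 * T₀ / t + 11600 * Δ ^ 3 * (12 * Δ ^ 2 * N ^ 2 * T₀ / t)) *
            (9 * Δ ^ 3) := by
            gcongr
            refine hcount.trans ?_
            gcongr
        _ = (2592 * Δ ^ 5 + 1252800 * Δ ^ 8) * (N ^ 2 * T₀ / t) := by ring
        _ ≤ (2592 * Δ ^ 8 + 1252800 * Δ ^ 8) * (N ^ 2 * T₀ / t) := by gcongr
        _ ≤ 1300000 * Δ ^ 8 * (N ^ 2 * T₀ / t) := by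
            gcongr
            have : 0 < Δ ^ 8 := by positivity
            linarith
        _ = _ := by ring
    · intro p hp
      obtain ⟨-, htp⟩ := mem_filter.mp hp
      refine exists_short_vector hΔ hNr ?_ ha1 (hale.trans htp) har
      -- A difference with large `gcd (h, r)` is attained too rarely to be popular.
      by_contra hR
      have h1 := card_diffPairs_le_of_div_gcd_le (J := J) hΔ (p.2.1 - p.1.1) (not_lt.mp hR)
      have h2 : 48 * Δ * (N : ℝ) ^ 2 / r ≤ 48 * Δ ^ 2 * T₀ := by
        calc 48 * Δ * (N : ℝ) ^ 2 / r = 48 * Δ * (N ^ 2 / r) := by ring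
          _ ≤ 48 * Δ ^ 2 * T₀ := by gcongr; nlinarith
      linarith

end

/-! ### Close pairs of roots in the coprime case. -/

theorem card_int_window_eq_le {r : ℕ} (hr : 0 < r) (H : ℕ) (c : ZMod r) :
    (#{δ ∈ Ioo (-(H : ℤ)) H | ((δ : ℤ) : ZMod r) = c} : ℝ) ≤ 1 + 2 * H / r := by
  have h := card_le_of_dvd_sub (S := {δ ∈ Ioo (-(H : ℤ)) H | ((δ : ℤ) : ZMod r) = c})
    (Λ := 2 * H) hr ?_ ?_
  · calc _ ≤ ((2 * H / r + 1 : ℕ) : ℝ) := by exact_mod_cast h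
      _ = ((2 * H / r : ℕ) : ℝ) + 1 := by push_cast; ring
      _ ≤ ((2 * H : ℕ) : ℝ) / r + 1 := by gcongr; exact Nat.cast_div_le
      _ = _ := by push_cast; ring
  · intro x hx y hy
    rw [← ZMod.intCast_eq_intCast_iff_dvd_sub, (mem_filter.mp hx).2, (mem_filter.mp hy).2]
  · intro x hx y hy
    have h1 := mem_Ioo.mp (mem_filter.mp hx).1
    have h2 := mem_Ioo.mp (mem_filter.mp hy).1
    push_cast
    linarith

theorem card_closePairs_filter_le {r : ℕ} (hr : 0 < r) (X : Finset (ZMod r × ℕ)) (H : ℕ)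
    (U : Finset ((ZMod r × ℕ) × (ZMod r × ℕ))) :
    (#{w ∈ closePairs r X H | w.1 ∈ U} : ℝ) ≤ #U * (1 + 2 * H / r) := by
  refine card_le_mul_card_of_fibers (fun w => w.1) (fun w hw => (mem_filter.mp hw).2) ?_
  intro p _
  refine le_trans (Nat.cast_le.mpr (card_le_card_of_injOn (fun w => w.2) ?_ ?_))
    (card_int_window_eq_le hr H (p.2.1 - p.1.1))
  · intro w hw
    obtain ⟨hwU, rfl⟩ := mem_filter.mp hw
    obtain ⟨hwX, he⟩ := mem_filter.mp (mem_filter.mp hwU).1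
    exact mem_filter.mpr ⟨(mem_product.mp hwX).2, he.symm⟩
  · intro w hw w' hw' he
    exact Prod.ext ((mem_filter.mp hw).2.trans (mem_filter.mp hw').2.symm) he

/-- Close pairs have equal `m`, a popular difference, or an unpopular one. The factor `1 + 2 H / r`
allows for several integers of the window representing one residue. -/
theorem card_closePairs_rootPairs_le {r : ℕ} [NeZero r] {J : (ZMod r)ˣ} {N : ℕ} {Δ : ℝ}
    (hΔ : DominatesDivisors Δ r) (hNr : N ≤ r) {H : ℕ} (hH : 1 ≤ H) :
    (#(closePairs r (rootPairs r J N) H) : ℝ) ≤ 2000000 * Δ ^ 8 * (1 + 2 * H / r) *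
      (N * Real.sqrt (H * Real.sqrt (1 + N ^ 3 / r))) := by
  classical
  have hΔ1 := hΔ.one_le
  have hr : 0 < r := NeZero.pos r
  rcases Nat.eq_zero_or_pos N with rfl | hN
  · have : closePairs r (rootPairs r J 0) H = ∅ := by
      simp [closePairs, rootPairs]
    rw [this]
    simp
  set K := rootPairs r J N with hK
  set T₀ := Real.sqrt (1 + N ^ 3 / r) with hT₀
  have hT₀1 : 1 ≤ T₀ := Real.one_le_sqrt.mpr (le_add_of_nonneg_right (by positivity))
  have hHR : (1 : ℝ) ≤ H := by exact_mod_cast hH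
  have hNR : (1 : ℝ) ≤ N := by exact_mod_cast hN
  set V := Real.sqrt (H * T₀) with hV
  have hV1 : 1 ≤ V := Real.one_le_sqrt.mpr (one_le_mul_of_one_le_of_one_le hHR hT₀1)
  have hVsq : V * V = H * T₀ := Real.mul_self_sqrt (by positivity)
  -- Balances `N² T₀ / t` against `H t`: both equal `N V`, because `V² = H T₀`.
  set t : ℝ := N * V / H with ht
  have ht0 : 0 < t := by positivity
  set W := closePairs r K H with hW
  set U₁ := {p ∈ K ×ˢ K | p.1.2 = p.2.2} with hU₁
  set U₂ := {p ∈ offPairs r J N | t ≤ #(diffPairs r J N (p.2.1 - p.1.1))} with hU₂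
  set W₃ := {w ∈ W | w.1 ∈ offPairs r J N ∧ (#(diffPairs r J N (w.1.2.1 - w.1.1.1)) : ℝ) < t}
    with hW₃
  have hmemW : ∀ w ∈ W, w.1 ∈ K ×ˢ K ∧ w.2 ∈ Ioo (-(H : ℤ)) H ∧
      w.1.2.1 - w.1.1.1 = (w.2 : ZMod r) := fun w hw =>
    ⟨(mem_product.mp (mem_filter.mp hw).1).1, (mem_product.mp (mem_filter.mp hw).1).2,
      (mem_filter.mp hw).2⟩
  have hcover : W ⊆ {w ∈ W | w.1 ∈ U₁} ∪ {w ∈ W | w.1 ∈ U₂} ∪ W₃ := by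
    intro w hw
    have h1 := (hmemW w hw).1
    simp only [mem_union, mem_filter, hU₁, hU₂, hW₃, offPairs, ← hK]
    by_cases h2 : w.1.1.2 = w.1.2.2
    · exact Or.inl (Or.inl ⟨hw, h1, h2⟩)
    · rcases le_or_gt t (#(diffPairs r J N (w.1.2.1 - w.1.1.1)) : ℝ) with h3 | h3
      · exact Or.inl (Or.inr ⟨hw, ⟨h1, h2⟩, h3⟩)
      · exact Or.inr ⟨hw, ⟨h1, h2⟩, h3⟩
  have hc : (#W : ℝ) ≤ #{w ∈ W | w.1 ∈ U₁} + #{w ∈ W | w.1 ∈ U₂} + #W₃ := by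
    have h1 := (card_le_card hcover).trans ((card_union_le _ _).trans
      (Nat.add_le_add_right (card_union_le _ _) _))
    exact_mod_cast h1
  have hU₁c : (#U₁ : ℝ) ≤ 9 * Δ ^ 2 * N := by
    have h1 : (#U₁ : ℝ) ≤ #K * (3 * Δ) := by
      refine card_le_mul_card_of_fibers (fun p => p.1)
        (fun p hp => (mem_product.mp (mem_filter.mp hp).1).1) ?_
      intro x hx
      refine le_trans (Nat.cast_le.mpr (card_le_card_of_injOn (fun p => p.2.1) ?_ ?_))
        (card_sqrt_coprime_le (J := J) hΔ (mem_rootPairs.mp hx).2.1)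
      · intro p hp
        obtain ⟨hpU, rfl⟩ := mem_filter.mp hp
        obtain ⟨hpK, he⟩ := mem_filter.mp hpU
        have := (mem_rootPairs.mp (mem_product.mp hpK).2).2.2
        rw [← he] at this
        simpa using this
      · rintro ⟨⟨k, a⟩, ⟨k', a'⟩⟩ hp ⟨⟨l, b⟩, ⟨l', b'⟩⟩ hq he
        obtain ⟨hpU, rfl⟩ := mem_filter.mp hp
        obtain ⟨hqU, hq2⟩ := mem_filter.mp hq
        have e1 := (mem_filter.mp hpU).2
        have e2 := (mem_filter.mp hqU).2
        simp only [Prod.mk.injEq] at hq2 he e1 e2 ⊢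
        exact ⟨⟨hq2.1.symm, hq2.2.symm⟩, he, e1.symm.trans (hq2.2.symm.trans e2)⟩
    calc (#U₁ : ℝ) ≤ #K * (3 * Δ) := h1
      _ ≤ (3 * Δ * N) * (3 * Δ) := by gcongr; exact card_rootPairs_le hΔ
      _ = _ := by ring
  have hU₂c : (#U₂ : ℝ) ≤ 1300000 * Δ ^ 8 * (N * V) := by
    refine (card_popular_offPairs_le hΔ hN hNr ht0).trans (le_of_eq ?_)
    rw [ht, ← hT₀]
    have hV0 : V ≠ 0 := by positivity
    field_simp
    linear_combination -hVsq
  have hW₃c : (#W₃ : ℝ) ≤ 2 * (N * V) := by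
    have h1 : (#W₃ : ℝ) ≤ #(Ioo (-(H : ℤ)) H) * t := by
      refine card_le_mul_card_of_fibers (fun w => w.2)
        (fun w hw => (hmemW w (mem_filter.mp hw).1).2.1) ?_
      intro δ _
      rcases ({w ∈ W₃ | w.2 = δ}).eq_empty_or_nonempty with he | ⟨w₀, hw₀⟩
      · rw [he]; simp; positivity
      obtain ⟨hw₀', rfl⟩ := mem_filter.mp hw₀
      obtain ⟨hw₀W, -, hlt⟩ := mem_filter.mp hw₀'
      refine le_trans (Nat.cast_le.mpr (card_le_card_of_injOn (fun w => w.1) ?_ ?_)) hlt.le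
      · intro w hw
        obtain ⟨hw, he⟩ := mem_filter.mp hw
        obtain ⟨hwW, hoff, -⟩ := mem_filter.mp hw
        refine mem_filter.mpr ⟨hoff, ?_⟩
        rw [(hmemW w hwW).2.2, he, (hmemW w₀ hw₀W).2.2]
      · intro w hw w' hw' he
        exact Prod.ext he ((mem_filter.mp hw).2.trans (mem_filter.mp hw').2.symm)
    have h2 : (#(Ioo (-(H : ℤ)) H) : ℝ) ≤ 2 * H := by
      rw [Int.card_Ioo]
      have : ((H : ℤ) - -(H : ℤ) - 1).toNat ≤ 2 * H := by omega
      exact_mod_cast this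
    calc (#W₃ : ℝ) ≤ #(Ioo (-(H : ℤ)) H) * t := h1
      _ ≤ 2 * H * t := by gcongr
      _ = _ := by rw [ht]; field_simp
  have h1 := card_closePairs_filter_le hr K H U₁
  have h2 := card_closePairs_filter_le hr K H U₂
  set q : ℝ := 1 + 2 * H / r with hq
  have hq1 : 1 ≤ q := le_add_of_nonneg_right (by positivity)
  have hΔ8 : Δ ^ 2 ≤ Δ ^ 8 := pow_le_pow_right₀ hΔ1 (by norm_num)
  have hΔ8' : 1 ≤ Δ ^ 8 := one_le_pow₀ hΔ1
  have hNV : (N : ℝ) ≤ N * V := le_mul_of_one_le_right (by positivity) hV1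
  calc (#W : ℝ) ≤ #U₁ * q + #U₂ * q + #W₃ := by linarith
    _ ≤ 9 * Δ ^ 8 * (N * V) * q + 1300000 * Δ ^ 8 * (N * V) * q + 2 * (N * V) := by
        gcongr
        exact hU₁c.trans (by gcongr)
    _ ≤ 9 * Δ ^ 8 * (N * V) * q + 1300000 * Δ ^ 8 * (N * V) * q + 2 * (Δ ^ 8 * (N * V) * q) := by
        have h3 : (N : ℝ) * V ≤ Δ ^ 8 * (N * V) * q := by
          calc (N : ℝ) * V = 1 * (N * V) * 1 := by ring
            _ ≤ _ := by gcongr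
        linarith
    _ = 1300011 * (Δ ^ 8 * (N * V) * q) := by ring
    _ ≤ 2000000 * (Δ ^ 8 * (N * V) * q) := by gcongr; norm_num
    _ = _ := by ring

/-! ### Reduction of a common factor of `m` and `r` to the coprime case. -/

theorem DominatesDivisors.mono {Δ : ℝ} {r r' : ℕ} (h : DominatesDivisors Δ r) (hr : r' ≤ r) :
    DominatesDivisors Δ r' where
  one_le := h.one_le
  card_divisors_le n hn hle := h.card_divisors_le n hn (hle.trans (by gcongr))
  log_le n hn hle := h.log_le n hn (hle.trans (by gcongr))

/-- Modular square roots `k` of `j m` modulo `r`, for `1 ≤ m ≤ M` with `gcd (m, r) = D`. -/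
def gcdRootPairs (r : ℕ) [NeZero r] (j M D : ℕ) : Finset (ZMod r × ℕ) :=
  {x ∈ univ ×ˢ Icc 1 M | x.2.gcd r = D ∧ x.1 ^ 2 = (j : ZMod r) * x.2}

theorem mem_gcdRootPairs {r : ℕ} [NeZero r] {j M D : ℕ} {x : ZMod r × ℕ} :
    x ∈ gcdRootPairs r j M D ↔
      (1 ≤ x.2 ∧ x.2 ≤ M) ∧ x.2.gcd r = D ∧ x.1 ^ 2 = (j : ZMod r) * x.2 := by
  simp [gcdRootPairs]

/-- The square root of `D = e² f` divides every square root of a multiple of `D` modulo `r`. -/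
theorem exists_eq_mul_of_mem_gcdRootPairs {r : ℕ} [NeZero r] {j M e f r' : ℕ}
    (hf : Squarefree f) (hr : r = e ^ 2 * f * r') {x : ZMod r × ℕ}
    (hx : x ∈ gcdRootPairs r j M (e ^ 2 * f)) :
    ∃ κ m' : ℕ, x.1.val = e * f * κ ∧ x.2 = e ^ 2 * f * m' ∧ m'.Coprime r' ∧
      (f : ZMod r') * (κ : ZMod r') ^ 2 = j * m' := by
  obtain ⟨-, hg, hsq⟩ := mem_gcdRootPairs.mp hx
  have hr0 : 0 < r := NeZero.pos r
  have hD0 : 0 < e ^ 2 * f := by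
    rw [← hg]; exact Nat.gcd_pos_of_pos_right _ hr0
  have he0 : e ≠ 0 := by rintro rfl; simp at hD0
  obtain ⟨m', hm'⟩ : e ^ 2 * f ∣ x.2 := hg ▸ Nat.gcd_dvd_left _ _
  have hmod : x.1.val ^ 2 ≡ j * x.2 [MOD r] := by
    rw [← ZMod.natCast_eq_natCast_iff]
    push_cast
    rw [ZMod.natCast_zmod_val, hsq]
  have hdvd : e ^ 2 * f ∣ x.1.val ^ 2 := by
    have h1 : x.1.val ^ 2 ≡ j * x.2 [MOD e ^ 2 * f] := hmod.of_dvd ⟨r', hr⟩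
    rw [hm'] at h1
    exact (h1.dvd_iff dvd_rfl).mpr (Dvd.intro _ (by ring : e ^ 2 * f * (m' * j) = _))
  have hgk : e * f ∣ x.1.val := by
    have h1 : e ∣ x.1.val :=
      (Nat.pow_dvd_pow_iff two_ne_zero).mp ((Dvd.intro _ rfl).trans hdvd)
    obtain ⟨c, hc⟩ := h1
    rw [hc, mul_pow] at hdvd
    have h2 := Nat.dvd_of_mul_dvd_mul_left (by positivity) hdvd
    rw [hc]
    exact Nat.mul_dvd_mul_left e ((hf.dvd_pow_iff_dvd two_ne_zero).mp h2)
  obtain ⟨κ, hκ⟩ := hgk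
  refine ⟨κ, m', hκ, hm', ?_, ?_⟩
  · rw [hm', hr, Nat.gcd_mul_left] at hg
    exact Nat.eq_of_mul_eq_mul_left hD0 (by rw [hg, mul_one])
  · have h1 : e ^ 2 * f * (f * κ ^ 2) ≡ e ^ 2 * f * (j * m') [MOD e ^ 2 * f * r'] := by
      rw [← hr]
      have h2 : e ^ 2 * f * (f * κ ^ 2) = x.1.val ^ 2 := by rw [hκ]; ring
      have h3 : e ^ 2 * f * (j * m') = j * x.2 := by rw [hm']; ring
      rw [h2, h3]
      exact hmod
    have h4 := Nat.ModEq.mul_left_cancel' hD0.ne' h1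
    rw [← ZMod.natCast_eq_natCast_iff] at h4
    push_cast at h4
    exact h4

/-- Dividing roots by `e f` and `m` by `e² f` gives root pairs modulo `r'` with `J = j / f`. The
reduced root is known modulo `e r'`, so passing to modulus `r'` loses a factor `e`. It is lost only
once, because the first root and the difference determine the second. -/
theorem card_closePairs_gcdRootPairs_le_mul {r : ℕ} [NeZero r] {j M e f r' : ℕ} [NeZero r']
    (hf : Squarefree f) (hr : r = e ^ 2 * f * r') (hj : j.Coprime r) (hfr : f.Coprime r') (H : ℕ) :
    ∃ J : (ZMod r')ˣ, #(closePairs r (gcdRootPairs r j M (e ^ 2 * f)) H) ≤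
      e * #(closePairs r' (rootPairs r' J (M / (e ^ 2 * f))) (H / (e * f) + 1)) := by
  classical
  have hr0 : 0 < r := NeZero.pos r
  have hr'0 : 0 < r' := NeZero.pos r'
  have hD0 : 0 < e ^ 2 * f := Nat.pos_of_ne_zero fun h => by rw [h] at hr; omega
  have he0 : 0 < e := Nat.pos_of_ne_zero (by rintro rfl; simp at hD0)
  have hf0 : 0 < f := Nat.pos_of_ne_zero (by rintro rfl; simp at hD0)
  have hg0 : 0 < e * f := Nat.mul_pos he0 hf0
  have hjr : j.Coprime r' := hj.coprime_dvd_right ⟨e ^ 2 * f, by rw [hr]; ring⟩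
  refine ⟨ZMod.unitOfCoprime j hjr * (ZMod.unitOfCoprime f hfr)⁻¹, ?_⟩
  set J := ZMod.unitOfCoprime j hjr * (ZMod.unitOfCoprime f hfr)⁻¹ with hJ
  have hJf : (J : ZMod r') * f = j := by
    have h1 := Units.inv_mul (ZMod.unitOfCoprime f hfr)
    rw [ZMod.coe_unitOfCoprime] at h1
    rw [hJ, Units.val_mul, mul_assoc, h1, mul_one, ZMod.coe_unitOfCoprime]
  have hfu : IsUnit (f : ZMod r') := (ZMod.isUnit_iff_coprime f r').mpr hfr
  set K := gcdRootPairs r j M (e ^ 2 * f) with hK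
  set φ : ZMod r × ℕ → ZMod r' × ℕ := fun x => ((x.1.val / (e * f) : ℕ), x.2 / (e ^ 2 * f)) with hφ
  have hφ_mem : ∀ x ∈ K, φ x ∈ rootPairs r' J (M / (e ^ 2 * f)) := by
    intro x hx
    obtain ⟨κ, m', hκ, hm', hco, heq⟩ := exists_eq_mul_of_mem_gcdRootPairs hf hr hx
    obtain ⟨⟨h1, h2⟩, -⟩ := mem_gcdRootPairs.mp hx
    have h3 : φ x = ((κ : ZMod r'), m') := by
      simp only [hφ, hκ, hm', Nat.mul_div_cancel_left _ hg0, Nat.mul_div_cancel_left _ hD0]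
    rw [h3]
    refine mem_rootPairs.mpr ⟨⟨?_, ?_⟩, hco, ?_⟩
    · rw [hm'] at h1
      exact Nat.pos_of_mul_pos_left h1
    · rw [hm'] at h2
      exact (Nat.le_div_iff_mul_le hD0).mpr (by rwa [mul_comm])
    · simp only
      apply hfu.mul_left_cancel
      rw [heq, ← mul_assoc, mul_comm (f : ZMod r'), hJf]
  have hwδ : ∀ w ∈ closePairs r K H, w.1.1 ∈ K ∧ w.1.2 ∈ K ∧ w.2.natAbs < H ∧
      w.1.2.1 - w.1.1.1 = (w.2 : ZMod r) ∧ ∃ q : ℤ, w.2 = (e * f : ℕ) * q ∧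
        ((e * r' : ℕ) : ℤ) ∣ q - ((w.1.2.1.val / (e * f) : ℕ) - (w.1.1.1.val / (e * f) : ℕ)) := by
    intro w hw
    obtain ⟨hw, he⟩ := mem_filter.mp hw
    obtain ⟨hw, hI⟩ := mem_product.mp hw
    obtain ⟨hx, hy⟩ := mem_product.mp hw
    have hI' := mem_Ioo.mp hI
    refine ⟨hx, hy, by omega, he, ?_⟩
    obtain ⟨κ, m, hκ, -⟩ := exists_eq_mul_of_mem_gcdRootPairs hf hr hx
    obtain ⟨κ', m', hκ', -⟩ := exists_eq_mul_of_mem_gcdRootPairs hf hr hy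
    have h1 : (r : ℤ) ∣ w.2 - ((w.1.2.1.val : ℤ) - w.1.1.1.val) := by
      rw [← ZMod.intCast_zmod_eq_zero_iff_dvd]
      push_cast
      rw [ZMod.natCast_zmod_val, ZMod.natCast_zmod_val, he, sub_self]
    obtain ⟨c, hc⟩ := h1
    refine ⟨(κ' - κ : ℤ) + e * r' * c, ?_, ?_⟩
    · have h2 : w.2 = ((w.1.2.1.val : ℤ) - w.1.1.1.val) + r * c := by linarith
      rw [h2, hκ, hκ', hr]
      push_cast
      ring
    · rw [hκ, hκ', Nat.mul_div_cancel_left _ hg0, Nat.mul_div_cancel_left _ hg0]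
      exact ⟨c, by push_cast; ring⟩
  set Φ : ((ZMod r × ℕ) × (ZMod r × ℕ)) × ℤ → (((ZMod r' × ℕ) × (ZMod r' × ℕ)) × ℤ) × ℕ :=
    fun w => (((φ w.1.1, φ w.1.2), w.2 / (e * f : ℕ)), w.1.1.1.val / (e * f) / r') with hΦ
  have hgZ : ((e * f : ℕ) : ℤ) ≠ 0 := by exact_mod_cast hg0.ne'
  rw [mul_comm e, ← card_range e, ← card_product, card_range]
  refine card_le_card_of_injOn Φ ?_ ?_
  · intro w hw
    obtain ⟨hx, hy, hδ, he, q, hq, hqd⟩ := hwδ w hw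
    have hdiv : w.2 / (e * f : ℕ) = q := by rw [hq, Int.mul_ediv_cancel_left _ hgZ]
    simp only [hΦ, hdiv, coe_product, Set.mem_prod, mem_coe, mem_range]
    refine ⟨?_, ?_⟩
    · refine mem_filter.mpr ⟨mem_product.mpr ⟨mem_product.mpr ⟨hφ_mem _ hx, hφ_mem _ hy⟩, ?_⟩, ?_⟩
      · have h1 : q.natAbs * (e * f) ≤ H := by
          have h2 := congrArg Int.natAbs hq
          rw [Int.natAbs_mul, Int.natAbs_natCast] at h2
          rw [mul_comm, ← h2]
          exact hδ.le
        have h3 := (Nat.le_div_iff_mul_le hg0).mpr h1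
        rw [mem_Ioo]
        simp only
        generalize H / (e * f) = z at *
        omega
      · have h1 : (r' : ℤ) ∣ q - ((w.1.2.1.val / (e * f) : ℕ) - (w.1.1.1.val / (e * f) : ℕ)) :=
          dvd_trans ⟨e, by push_cast; ring⟩ hqd
        rw [← ZMod.intCast_zmod_eq_zero_iff_dvd] at h1
        rw [Int.cast_sub, Int.cast_sub, Int.cast_natCast, Int.cast_natCast] at h1
        simp only [hφ]
        exact (sub_eq_zero.mp h1).symm
    · rw [Nat.div_div_eq_div_mul, Nat.div_lt_iff_lt_mul (Nat.mul_pos hg0 hr'0)]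
      refine (ZMod.val_lt w.1.1.1).trans_le (le_of_eq ?_)
      rw [hr]; ring
  · intro w hw w' hw' hww
    obtain ⟨hx, hy, hδ, he, q, hq, hqd⟩ := hwδ w hw
    obtain ⟨hx', hy', hδ', he', q', hq', hqd'⟩ := hwδ w' hw'
    have hdiv : w.2 / (e * f : ℕ) = q := by rw [hq, Int.mul_ediv_cancel_left _ hgZ]
    have hdiv' : w'.2 / (e * f : ℕ) = q' := by rw [hq', Int.mul_ediv_cancel_left _ hgZ]
    simp only [hΦ, hφ, Prod.mk.injEq, hdiv, hdiv'] at hww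
    obtain ⟨⟨⟨⟨h1, h2⟩, h3, h4⟩, h5⟩, h6⟩ := hww
    obtain ⟨κ, m, hκ, hm, -⟩ := exists_eq_mul_of_mem_gcdRootPairs hf hr hx
    obtain ⟨κ', m', hκ', hm', -⟩ := exists_eq_mul_of_mem_gcdRootPairs hf hr hx'
    obtain ⟨μ, n, -, hn, -⟩ := exists_eq_mul_of_mem_gcdRootPairs hf hr hy
    obtain ⟨μ', n', -, hn', -⟩ := exists_eq_mul_of_mem_gcdRootPairs hf hr hy'
    rw [hκ, hκ', Nat.mul_div_cancel_left _ hg0, Nat.mul_div_cancel_left _ hg0] at h1 h6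
    rw [hm, hm', Nat.mul_div_cancel_left _ hD0, Nat.mul_div_cancel_left _ hD0] at h2
    rw [hn, hn', Nat.mul_div_cancel_left _ hD0, Nat.mul_div_cancel_left _ hD0] at h4
    have h7 : κ = κ' := by
      have h8 : κ % r' = κ' % r' := (ZMod.natCast_eq_natCast_iff' _ _ _).mp h1
      rw [← Nat.div_add_mod κ r', ← Nat.div_add_mod κ' r', h6, h8]
    have hδe : w.2 = w'.2 := by rw [hq, hq', h5]
    have hx1 : w.1.1.1 = w'.1.1.1 := ZMod.val_injective r (by rw [hκ, hκ', h7])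
    have hy1 : w.1.2.1 = w'.1.2.1 := by
      rw [← sub_add_cancel w.1.2.1 w.1.1.1, ← sub_add_cancel w'.1.2.1 w'.1.1.1, he, he', hδe, hx1]
    exact Prod.ext (Prod.ext (Prod.ext hx1 (by rw [hm, hm', h2]))
      (Prod.ext hy1 (by rw [hn, hn', h4]))) hδe

theorem card_closePairs_gcdRootPairs_le {r : ℕ} [NeZero r] {j M D : ℕ} {Δ : ℝ}
    (hΔ : DominatesDivisors Δ r) (hj : j.Coprime r) (hMr : M ≤ r) (hD : D ∣ r) {H : ℕ}
    (hH : 1 ≤ H) (hHr : H ≤ r) :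
    (#(closePairs r (gcdRootPairs r j M D) H) : ℝ) ≤
      20000000 * Δ ^ 8 * (M * Real.sqrt (H * Real.sqrt (1 + M ^ 3 / r))) := by
  have hΔ1 := hΔ.one_le
  have hr0 : 0 < r := NeZero.pos r
  obtain ⟨f, e, rfl, hf⟩ := Nat.sq_mul_squarefree D
  obtain ⟨r', hr⟩ := hD
  rcases (gcdRootPairs r j M (e ^ 2 * f)).eq_empty_or_nonempty with hemp | ⟨x, hx⟩
  · have : closePairs r (gcdRootPairs r j M (e ^ 2 * f)) H = ∅ := by
      rw [hemp]; simp [closePairs]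
    rw [this]
    simp only [card_empty, Nat.cast_zero]
    positivity
  have hr'0 : 0 < r' := Nat.pos_of_ne_zero fun h => by rw [h] at hr; omega
  have : NeZero r' := ⟨hr'0.ne'⟩
  have hD0 : 0 < e ^ 2 * f := Nat.pos_of_ne_zero fun h => by rw [h] at hr; omega
  have he0 : 0 < e := Nat.pos_of_ne_zero (by rintro rfl; simp at hD0)
  have hf0 : 0 < f := Nat.pos_of_ne_zero (by rintro rfl; simp at hD0)
  have hjr : j.Coprime r' := hj.coprime_dvd_right ⟨e ^ 2 * f, by rw [hr]; ring⟩
  -- A single root suffices: `f κ² = j m'` is a unit modulo `r'`.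
  have hfr : f.Coprime r' := by
    obtain ⟨κ, m', -, -, hco, heq⟩ := exists_eq_mul_of_mem_gcdRootPairs hf hr hx
    rw [← ZMod.isUnit_iff_coprime]
    refine isUnit_of_mul_isUnit_left (y := (κ : ZMod r') ^ 2) ?_
    rw [heq]
    exact ((ZMod.isUnit_iff_coprime j r').mpr hjr).mul ((ZMod.isUnit_iff_coprime m' r').mpr hco)
  obtain ⟨J, hJ⟩ := card_closePairs_gcdRootPairs_le_mul (M := M) hf hr hj hfr H
  have hr'r : r' ≤ r := Nat.le_of_dvd hr0 ⟨e ^ 2 * f, by rw [hr]; ring⟩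
  set N := M / (e ^ 2 * f) with hN
  set H' := H / (e * f) + 1 with hH'
  have hNr : N ≤ r' := by
    rw [hN]
    refine (Nat.div_le_div_right hMr).trans ?_
    rw [hr, Nat.mul_div_cancel_left _ hD0]
  have hmain := card_closePairs_rootPairs_le (J := J) (hΔ.mono hr'r) hNr (H := H') (Nat.le_add_left _ _)
  have hDR : (e : ℝ) ^ 2 * f * r' = r := by exact_mod_cast hr.symm
  have heR : (1 : ℝ) ≤ e := by exact_mod_cast he0
  have hfR : (1 : ℝ) ≤ f := by exact_mod_cast hf0
  have hr'R : (0 : ℝ) < r' := by exact_mod_cast hr'0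
  have hrR : (0 : ℝ) < r := by exact_mod_cast hr0
  have hDR1 : (1 : ℝ) ≤ e ^ 2 * f := one_le_mul_of_one_le_of_one_le (one_le_pow₀ heR) hfR
  have hNM : (N : ℝ) ≤ M / (e ^ 2 * f) := Nat.cast_div_le.trans (by push_cast; rfl)
  have hHR : (1 : ℝ) ≤ H := by exact_mod_cast hH
  have hH'le : (H' : ℝ) ≤ H / (e * f) + 1 := by
    rw [hH']
    push_cast
    gcongr
    exact Nat.cast_div_le.trans (by push_cast; rfl)
  have hH'2 : (H' : ℝ) ≤ 4 * H := by
    have : (H : ℝ) / (e * f) ≤ H := div_le_self (by positivity)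
      (one_le_mul_of_one_le_of_one_le heR hfR)
    linarith
  -- The window may wrap around the smaller modulus about `e` times. This loss and the factor `e`
  -- from the reduction are both absorbed by `N ≤ M / (e² f)`.
  have hfac : 1 + 2 * (H' : ℝ) / r' ≤ 5 * e := by
    have h1 : (H : ℝ) / (e * f) / r' ≤ e := by
      rw [div_div, div_le_iff₀ (by positivity)]
      calc (H : ℝ) ≤ r := by exact_mod_cast hHr
        _ = e * (e * f * r') := by rw [← hDR]; ring
    have h2 : 1 / (r' : ℝ) ≤ 1 := by
      rw [div_le_one hr'R]; exact_mod_cast hr'0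
    calc 1 + 2 * (H' : ℝ) / r' ≤ 1 + 2 * (H / (e * f) + 1) / r' := by gcongr
      _ = 1 + 2 * (H / (e * f) / r') + 2 * (1 / r') := by ring
      _ ≤ 1 + 2 * e + 2 * 1 := by gcongr
      _ ≤ _ := by linarith
  have hNe : (e : ℝ) * (5 * e) * N ≤ 5 * M := by
    calc (e : ℝ) * (5 * e) * N ≤ e * (5 * e) * (M / (e ^ 2 * f)) := by gcongr
      _ = 5 * M / f := by field_simp
      _ ≤ 5 * M := div_le_self (by positivity) hfR
  have hT : (N : ℝ) ^ 3 / r' ≤ M ^ 3 / r := by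
    rw [div_le_div_iff₀ hr'R hrR]
    calc (N : ℝ) ^ 3 * r ≤ ((M : ℝ) / (e ^ 2 * f)) ^ 3 * r := by gcongr
      _ = (M : ℝ) ^ 3 * r' / (e ^ 2 * f) ^ 2 := by rw [← hDR]; field_simp
      _ ≤ (M : ℝ) ^ 3 * r' := div_le_self (by positivity) (one_le_pow₀ hDR1)
  have hV : Real.sqrt (H' * Real.sqrt (1 + N ^ 3 / r')) ≤
      2 * Real.sqrt (H * Real.sqrt (1 + M ^ 3 / r)) := by
    have h2 : (2 : ℝ) = Real.sqrt 4 := by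
      rw [show (4 : ℝ) = 2 ^ 2 by norm_num, Real.sqrt_sq (by norm_num)]
    rw [h2, ← Real.sqrt_mul (by norm_num), ← mul_assoc]
    gcongr
  calc (#(closePairs r (gcdRootPairs r j M (e ^ 2 * f)) H) : ℝ)
      ≤ e * #(closePairs r' (rootPairs r' J N) H') := by exact_mod_cast hJ
    _ ≤ e * (2000000 * Δ ^ 8 * (1 + 2 * H' / r') *
          (N * Real.sqrt (H' * Real.sqrt (1 + N ^ 3 / r')))) := by gcongr
    _ ≤ e * (2000000 * Δ ^ 8 * (5 * e) *
          (N * (2 * Real.sqrt (H * Real.sqrt (1 + M ^ 3 / r))))) := by gcongr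
    _ = 4000000 * Δ ^ 8 * ((e * (5 * e) * N) * Real.sqrt (H * Real.sqrt (1 + M ^ 3 / r))) := by ring
    _ ≤ 4000000 * Δ ^ 8 * ((5 * M) * Real.sqrt (H * Real.sqrt (1 + M ^ 3 / r))) := by gcongr
    _ = _ := by ring

/-! ### Assembly of the bilinear bound. -/

theorem exists_dominatesDivisors {η : ℝ} (hη : 0 < η) :
    ∃ C : ℝ, 1 ≤ C ∧ ∀ r : ℕ, 0 < r → DominatesDivisors (C * (r : ℝ) ^ η) r := by
  obtain ⟨C₁, hC₁, hdiv⟩ := exists_card_divisors_le_rpow (show 0 < η / 4 by positivity)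
  set C₂ : ℝ := C₁ * (2400 : ℝ) ^ (η / 4) with hC₂
  have hC₂0 : 0 ≤ C₂ := by positivity
  have hη' : 0 ≤ 1 / η := by positivity
  refine ⟨C₂ + 4 + 1 / η, by linarith, fun r hr => ?_⟩
  have hr1 : (1 : ℝ) ≤ r := by exact_mod_cast hr
  have hrη : (1 : ℝ) ≤ (r : ℝ) ^ η := Real.one_le_rpow hr1 hη.le
  refine ⟨?_, ?_, ?_⟩
  · nlinarith
  · intro n hn hle
    have hleR : (n : ℝ) ≤ 2400 * (r : ℝ) ^ 4 := by exact_mod_cast hle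
    calc (#n.divisors : ℝ) ≤ C₁ * (n : ℝ) ^ (η / 4) := hdiv n hn
      _ ≤ C₁ * (2400 * (r : ℝ) ^ 4) ^ (η / 4) := by gcongr
      _ = C₂ * (r : ℝ) ^ η := by
          rw [Real.mul_rpow (by norm_num) (by positivity), ← Real.rpow_natCast,
            ← Real.rpow_mul (by positivity), hC₂, mul_assoc]
          congr 3
          push_cast
          ring
      _ ≤ _ := by gcongr; linarith
  · intro n hn hle
    have hleR : (n : ℝ) ≤ 16 * (r : ℝ) := by exact_mod_cast hle
    have hn0 : (0 : ℝ) < n := by exact_mod_cast hn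
    have h1 : Real.log n ≤ Real.log 16 + Real.log r := by
      rw [← Real.log_mul (by norm_num) (by positivity)]
      exact Real.log_le_log hn0 hleR
    have h2 : Real.log 16 ≤ 3 := by
      rw [show (16 : ℝ) = 2 ^ 4 by norm_num, Real.log_pow]
      push_cast
      linarith [Real.log_two_lt_d9]
    have h3 : Real.log r ≤ (r : ℝ) ^ η / η := Real.log_le_rpow_div (by positivity) hη
    calc 1 + Real.log n ≤ 4 * 1 + (1 / η) * (r : ℝ) ^ η := by
          rw [one_div_mul_eq_div]; linarith
      _ ≤ 4 * (r : ℝ) ^ η + (1 / η) * (r : ℝ) ^ η := by gcongr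
      _ ≤ C₂ * (r : ℝ) ^ η + 4 * (r : ℝ) ^ η + (1 / η) * (r : ℝ) ^ η := by
          have : 0 ≤ C₂ * (r : ℝ) ^ η := by positivity
          linarith
      _ = _ := by ring

theorem sum_modSqrt_eq_sum_gcdRootPairs (r : ℕ) [NeZero r] (j N : ℕ) (β : ℕ → ℂ) (l : ℤ) :
    ∑ m ∈ Icc 1 N, ∑ k ∈ modSqrt r (j * m), β m * eMod r (l * k) =
      ∑ D ∈ r.divisors, ∑ x ∈ gcdRootPairs r j N D,
        β x.2 * ZMod.stdAddChar ((l : ZMod r) * x.1) := by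
  have hr : r ≠ 0 := NeZero.ne r
  have h1 : ∀ D, gcdRootPairs r j N D =
      {x ∈ {x ∈ (univ : Finset (ZMod r)) ×ˢ Icc 1 N | x.1 ^ 2 = (j : ZMod r) * x.2} |
        x.2.gcd r = D} := by
    intro D
    ext x
    simp only [gcdRootPairs, mem_filter]
    tauto
  simp_rw [h1]
  rw [sum_fiberwise_of_maps_to
    (fun x _ => Nat.mem_divisors.mpr ⟨Nat.gcd_dvd_right x.2 r, hr⟩), sum_filter,
    sum_product_right]
  refine sum_congr rfl fun m _ => ?_
  rw [← sum_filter]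
  refine sum_bij' (fun k _ => (k : ZMod r)) (fun k _ => k.val) ?_ ?_ ?_ ?_ ?_
  · intro k hk
    have h2 := (mem_filter.mp hk).2
    rw [← ZMod.natCast_eq_natCast_iff] at h2
    push_cast at h2
    exact mem_filter.mpr ⟨mem_univ _, h2⟩
  · intro k hk
    refine mem_filter.mpr ⟨mem_range.mpr (ZMod.val_lt k), ?_⟩
    rw [← ZMod.natCast_eq_natCast_iff]
    push_cast
    rw [ZMod.natCast_zmod_val]
    exact (mem_filter.mp hk).2
  · intro k hk
    exact ZMod.val_cast_of_lt (mem_range.mp (mem_filter.mp hk).1)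
  · intro k _
    exact ZMod.natCast_zmod_val k
  · intro k _
    rw [eMod_eq_stdAddChar]

theorem norm_le_normInf {M : ℝ} (β : ℕ → ℂ) {m : ℕ} (hm : m ∈ mRange M) :
    ‖β m‖ ≤ normInf M β := by
  have : ‖β m‖₊ ≤ (mRange M).sup fun m => ‖β m‖₊ := le_sup (f := fun m => ‖β m‖₊) hm
  exact_mod_cast this

/-- The assumption `r ≤ M³` bounds the inner root by a multiple of `M^(3/2) r^(-1/2)`, and `H Λ ≤ r`
then removes `H`. -/
theorem mul_sqrt_le {L M r Λ H N : ℝ} (hΛ : 0 ≤ Λ) (hH : 0 ≤ H) (hN : 0 ≤ N) (hr : 0 < r)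
    (hM : 0 < M) (hΛL : Λ ≤ L) (hHΛ : H * Λ ≤ r) (hNM : N ≤ M) (hrM : r ≤ M ^ 3) :
    Λ * (N * Real.sqrt (H * Real.sqrt (1 + N ^ 3 / r))) ≤
      2 * (L ^ (1 / 4 : ℝ) * M ^ (7 / 8 : ℝ) * r ^ (1 / 8 : ℝ)) ^ 2 := by
  have hL : 0 ≤ L := hΛ.trans hΛL
  have hT : Real.sqrt (1 + N ^ 3 / r) ≤ 4 * (M ^ (3 / 2 : ℝ) * r ^ (-(1 / 2) : ℝ)) := by
    refine Real.sqrt_le_iff.mpr ⟨by positivity, ?_⟩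
    have h1 : (M ^ (3 / 2 : ℝ) * r ^ (-(1 / 2) : ℝ)) ^ 2 = M ^ 3 / r := by
      rw [mul_pow, ← Real.rpow_natCast, ← Real.rpow_natCast, ← Real.rpow_mul hM.le,
        ← Real.rpow_mul hr.le]
      norm_num
      rw [Real.rpow_neg_one, div_eq_mul_inv]
    rw [mul_pow, h1]
    have h2 : 1 ≤ M ^ 3 / r := (one_le_div hr).mpr hrM
    have h3 : N ^ 3 / r ≤ M ^ 3 / r := by gcongr
    linarith
  have hsq : (L ^ (1 / 4 : ℝ) * M ^ (7 / 8 : ℝ) * r ^ (1 / 8 : ℝ)) ^ 2 =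
      M * (L ^ (1 / 2 : ℝ) * M ^ (3 / 4 : ℝ) * r ^ (1 / 4 : ℝ)) := by
    have e1 : (L ^ (1 / 4 : ℝ)) ^ 2 = L ^ (1 / 2 : ℝ) := by
      rw [← Real.rpow_natCast, ← Real.rpow_mul hL]; norm_num
    have e2 : (M ^ (7 / 8 : ℝ)) ^ 2 = M * M ^ (3 / 4 : ℝ) := by
      rw [← Real.rpow_natCast, ← Real.rpow_mul hM.le]
      nth_rw 2 [← Real.rpow_one M]
      rw [← Real.rpow_add hM]; norm_num
    have e3 : (r ^ (1 / 8 : ℝ)) ^ 2 = r ^ (1 / 4 : ℝ) := by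
      rw [← Real.rpow_natCast, ← Real.rpow_mul hr.le]; norm_num
    rw [mul_pow, mul_pow, e1, e2, e3]
    ring
  have hmain : Λ * Real.sqrt (H * Real.sqrt (1 + N ^ 3 / r)) ≤
      2 * (L ^ (1 / 2 : ℝ) * M ^ (3 / 4 : ℝ) * r ^ (1 / 4 : ℝ)) := by
    refine abs_le_of_sq_le_sq' ?_ (by positivity) |>.2
    rw [mul_pow, Real.sq_sqrt (by positivity)]
    have e1 : (L ^ (1 / 2 : ℝ)) ^ 2 = L := by
      rw [← Real.rpow_natCast, ← Real.rpow_mul hL]; norm_num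
    have e2 : (M ^ (3 / 4 : ℝ)) ^ 2 = M ^ (3 / 2 : ℝ) := by
      rw [← Real.rpow_natCast, ← Real.rpow_mul hM.le]; norm_num
    have e3 : (r ^ (1 / 4 : ℝ)) ^ 2 = r * r ^ (-(1 / 2) : ℝ) := by
      rw [← Real.rpow_natCast, ← Real.rpow_mul hr.le]
      nth_rw 2 [← Real.rpow_one r]
      rw [← Real.rpow_add hr]; norm_num
    calc Λ ^ 2 * (H * Real.sqrt (1 + N ^ 3 / r))
        = Λ * (H * Λ) * Real.sqrt (1 + N ^ 3 / r) := by ring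
      _ ≤ L * r * (4 * (M ^ (3 / 2 : ℝ) * r ^ (-(1 / 2) : ℝ))) := by gcongr
      _ = 4 * ((L ^ (1 / 2 : ℝ)) ^ 2 * (M ^ (3 / 4 : ℝ)) ^ 2 * (r ^ (1 / 4 : ℝ)) ^ 2) := by
          rw [e1, e2, e3]; ring
      _ = _ := by ring
  rw [hsq]
  calc Λ * (N * Real.sqrt (H * Real.sqrt (1 + N ^ 3 / r)))
      = N * (Λ * Real.sqrt (H * Real.sqrt (1 + N ^ 3 / r))) := by ring
    _ ≤ M * (2 * (L ^ (1 / 2 : ℝ) * M ^ (3 / 4 : ℝ) * r ^ (1 / 4 : ℝ))) := by gcongr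
    _ = _ := by ring

/-- Cauchy–Schwarz is used over `l` and over the divisors `D` of `r`; the latter adds `Δ²` to the
`Δ⁸` of each class, and the square root leaves `Δ⁵`. -/
theorem norm_bilinearSum_le {r j : ℕ} (hr : 0 < r) (hrj : r.Coprime j) {Δ : ℝ}
    (hΔ : DominatesDivisors Δ r) {L M : ℝ} (hL : 1 ≤ L) (hLr : L ≤ r)
    (hM : (r : ℝ) ^ (1 / 3 : ℝ) ≤ M) (hMr : M ≤ r) (α : ℤ → ℂ) (β : ℕ → ℂ) :
    ‖bilinearSum r j L M α β‖ ≤ 100000 * Δ ^ 5 *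
      (L ^ (1 / 4 : ℝ) * M ^ (7 / 8 : ℝ) * (r : ℝ) ^ (1 / 8 : ℝ)) * norm2 L α * normInf M β := by
  have : NeZero r := ⟨hr.ne'⟩
  have hΔ1 := hΔ.one_le
  have hrR : (1 : ℝ) ≤ r := by exact_mod_cast hr
  have hM1 : 1 ≤ M := (Real.one_le_rpow hrR (by norm_num)).trans hM
  have hrM3 : (r : ℝ) ≤ M ^ 3 := by
    calc (r : ℝ) = ((r : ℝ) ^ (1 / 3 : ℝ)) ^ 3 := by
          rw [← Real.rpow_natCast, ← Real.rpow_mul (by positivity)]; norm_num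
      _ ≤ M ^ 3 := by gcongr
  set Λ := ⌊L⌋₊ with hΛ
  set N := ⌊M⌋₊ with hN
  have hΛ1 : 1 ≤ Λ := Nat.le_floor (by exact_mod_cast hL)
  have hΛL : (Λ : ℝ) ≤ L := Nat.floor_le (by linarith)
  have hΛr : Λ ≤ r := by exact_mod_cast hΛL.trans hLr
  have hNM : (N : ℝ) ≤ M := Nat.floor_le (by linarith)
  have hNr : N ≤ r := by exact_mod_cast hNM.trans hMr
  have hlR : lRange L = Icc (-(Λ : ℤ)) Λ := by
    rw [lRange, hΛ, Int.natCast_floor_eq_floor (by linarith : (0 : ℝ) ≤ L)]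
  set b := normInf M β with hb
  have hb0 : 0 ≤ b := NNReal.coe_nonneg _
  set E := L ^ (1 / 4 : ℝ) * M ^ (7 / 8 : ℝ) * (r : ℝ) ^ (1 / 8 : ℝ) with hE
  have hE0 : 0 ≤ E := by positivity
  set f : ℕ → ℤ → ℂ := fun D l => ∑ x ∈ gcdRootPairs r j N D,
    β x.2 * ZMod.stdAddChar ((l : ZMod r) * x.1) with hf
  have hsum : bilinearSum r j L M α β = ∑ l ∈ lRange L, α l * ∑ D ∈ r.divisors, f D l := by
    rw [bilinearSum]
    refine sum_congr rfl fun l _ => ?_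
    rw [hf, ← sum_modSqrt_eq_sum_gcdRootPairs, mul_sum, mRange]
    refine sum_congr rfl fun m _ => ?_
    rw [mul_sum]
    exact sum_congr rfl fun k _ => by ring
  obtain ⟨H, hH1, hHΛ, hH⟩ := exists_sum_norm_sq_le_card_closePairs r hΛ1 hΛr
  have hHr : H ≤ r := (Nat.le_mul_of_pos_right _ hΛ1).trans hHΛ
  have hτ : (#r.divisors : ℝ) ≤ Δ := by
    refine hΔ.card_divisors_le r hr ?_
    have := Nat.le_self_pow (n := 4) (by norm_num) r
    omega
  have hfD : ∀ D ∈ r.divisors, ∑ l ∈ lRange L, ‖f D l‖ ^ 2 ≤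
      8000000000 * Δ ^ 8 * b ^ 2 * E ^ 2 := by
    intro D hD
    have h1 := hH (gcdRootPairs r j N D) β b hb0 fun x hx =>
      norm_le_normInf β (mem_Icc.mpr (mem_gcdRootPairs.mp hx).1)
    have h2 := card_closePairs_gcdRootPairs_le (M := N) hΔ hrj.symm hNr
      (Nat.dvd_of_mem_divisors hD) hH1 hHr
    have h3 := mul_sqrt_le (L := L) (M := M) (r := r) (Λ := Λ) (H := H) (N := N) (by positivity)
      (by positivity) (by positivity) (by positivity) (by positivity) hΛL (by exact_mod_cast hHΛ)
      hNM hrM3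
    rw [hlR]
    calc _ ≤ 192 * Λ * b ^ 2 * #(closePairs r (gcdRootPairs r j N D) H) := h1
      _ ≤ 192 * Λ * b ^ 2 * (20000000 * Δ ^ 8 *
            (N * Real.sqrt (H * Real.sqrt (1 + N ^ 3 / r)))) := by gcongr
      _ = 3840000000 * Δ ^ 8 * b ^ 2 *
            (Λ * (N * Real.sqrt (H * Real.sqrt (1 + N ^ 3 / r)))) := by ring
      _ ≤ 3840000000 * Δ ^ 8 * b ^ 2 * (2 * E ^ 2) := by gcongr
      _ = 7680000000 * (Δ ^ 8 * b ^ 2 * E ^ 2) := by ring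
      _ ≤ 8000000000 * (Δ ^ 8 * b ^ 2 * E ^ 2) := by gcongr; norm_num
      _ = _ := by ring
  have hF : ∑ l ∈ lRange L, ‖∑ D ∈ r.divisors, f D l‖ ^ 2 ≤
      8000000000 * Δ ^ 10 * b ^ 2 * E ^ 2 := by
    calc _ ≤ ∑ l ∈ lRange L, (#r.divisors : ℝ) * ∑ D ∈ r.divisors, ‖f D l‖ ^ 2 := by
          refine sum_le_sum fun l _ => ?_
          calc _ ≤ (∑ D ∈ r.divisors, ‖f D l‖) ^ 2 := by gcongr; exact norm_sum_le _ _
            _ ≤ _ := sq_sum_le_card_mul_sum_sq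
      _ = #r.divisors * ∑ D ∈ r.divisors, ∑ l ∈ lRange L, ‖f D l‖ ^ 2 := by
          rw [← mul_sum, sum_comm]
      _ ≤ #r.divisors * ∑ D ∈ r.divisors, 8000000000 * Δ ^ 8 * b ^ 2 * E ^ 2 := by
          gcongr with D hD
          exact hfD D hD
      _ = #r.divisors * (#r.divisors * (8000000000 * Δ ^ 8 * b ^ 2 * E ^ 2)) := by
          rw [sum_const, nsmul_eq_mul]
      _ ≤ Δ * (Δ * (8000000000 * Δ ^ 8 * b ^ 2 * E ^ 2)) := by gcongr
      _ = _ := by ring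
  have hn2 : norm2 L α ^ 2 = ∑ l ∈ lRange L, ‖α l‖ ^ 2 :=
    Real.sq_sqrt (sum_nonneg fun _ _ => by positivity)
  have hn20 : 0 ≤ norm2 L α := Real.sqrt_nonneg _
  refine abs_le_of_sq_le_sq' ?_ (by positivity) |>.2
  calc ‖bilinearSum r j L M α β‖ ^ 2
      ≤ (∑ l ∈ lRange L, ‖α l‖ * ‖∑ D ∈ r.divisors, f D l‖) ^ 2 := by
        rw [hsum]
        gcongr
        refine (norm_sum_le _ _).trans (le_of_eq ?_)
        exact sum_congr rfl fun l _ => norm_mul _ _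
    _ ≤ (∑ l ∈ lRange L, ‖α l‖ ^ 2) * ∑ l ∈ lRange L, ‖∑ D ∈ r.divisors, f D l‖ ^ 2 :=
        sum_mul_sq_le_sq_mul_sq _ _ _
    _ ≤ norm2 L α ^ 2 * (8000000000 * Δ ^ 10 * b ^ 2 * E ^ 2) := by
        rw [hn2]
        gcongr
    _ = 8000000000 * (Δ ^ 5 * E * norm2 L α * b) ^ 2 := by ring
    _ ≤ 10000000000 * (Δ ^ 5 * E * norm2 L α * b) ^ 2 := by gcongr; norm_num
    _ = _ := by ring

theorem exists_norm_bilinearSum_le (ε : ℝ) (hε : 0 < ε) :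
    ∃ C : ℝ, 0 < C ∧
      ∀ r j : ℕ, 0 < r → Nat.Coprime r j →
      ∀ L M : ℝ, 1 ≤ L → L ≤ (r : ℝ) → (r : ℝ) ^ (1 / 3 : ℝ) ≤ M → M ≤ (r : ℝ) →
      ∀ (α : ℤ → ℂ) (β : ℕ → ℂ),
        ‖bilinearSum r j L M α β‖ ≤
          C * (L ^ (1 / 4 : ℝ) * M ^ (7 / 8 : ℝ) * (r : ℝ) ^ (1 / 8 : ℝ))
            * norm2 L α * normInf M β * (r : ℝ) ^ ε := by
  obtain ⟨C, hC, hdom⟩ := exists_dominatesDivisors (show 0 < ε / 5 by positivity)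
  refine ⟨100000 * C ^ 5, by positivity, fun r j hr hrj L M hL hLr hM hMr α β => ?_⟩
  refine (norm_bilinearSum_le hr hrj (hdom r hr) hL hLr hM hMr α β).trans (le_of_eq ?_)
  have : ((r : ℝ) ^ (ε / 5)) ^ 5 = (r : ℝ) ^ ε := by
    rw [← Real.rpow_natCast, ← Real.rpow_mul (by positivity)]
    congr 1
    push_cast
    ring
  rw [mul_pow, this]
  ring

/-- The exponents match exactly: `(1/4 + 1/8)(1/3 + 3 ε) - ε = 1/8 + ε/8`. -/
theorem saving_of_le {ε r L M : ℝ} (hr : 0 < r) (hL : 0 < L) (hM : 0 < M)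
    (hrL : r ^ (1 / 3 + 3 * ε : ℝ) ≤ L) (hrM : r ^ (1 / 3 + 3 * ε : ℝ) ≤ M) :
    L ^ (1 / 4 : ℝ) * M ^ (7 / 8 : ℝ) * r ^ (1 / 8 : ℝ) * r ^ (ε / 8) ≤
      L ^ (1 / 2 : ℝ) * M * r ^ (-ε) := by
  set w := r ^ (1 / 3 + 3 * ε : ℝ) with hw
  have hw0 : 0 < w := Real.rpow_pos_of_pos hr _
  have h1 : L ^ (1 / 2 : ℝ) = L ^ (1 / 4 : ℝ) * L ^ (1 / 4 : ℝ) := by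
    rw [← Real.rpow_add hL]; norm_num
  have h2 : M = M ^ (7 / 8 : ℝ) * M ^ (1 / 8 : ℝ) := by
    rw [← Real.rpow_add hM]; norm_num
  have h3 : r ^ (1 / 8 : ℝ) * r ^ (ε / 8) = w ^ (1 / 4 : ℝ) * w ^ (1 / 8 : ℝ) * r ^ (-ε) := by
    rw [hw, ← Real.rpow_mul hr.le, ← Real.rpow_mul hr.le, ← Real.rpow_add hr,
      ← Real.rpow_add hr, ← Real.rpow_add hr]
    congr 1
    ring
  calc L ^ (1 / 4 : ℝ) * M ^ (7 / 8 : ℝ) * r ^ (1 / 8 : ℝ) * r ^ (ε / 8)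
      = L ^ (1 / 4 : ℝ) * M ^ (7 / 8 : ℝ) * (r ^ (1 / 8 : ℝ) * r ^ (ε / 8)) := by ring
    _ = L ^ (1 / 4 : ℝ) * M ^ (7 / 8 : ℝ) *
          (w ^ (1 / 4 : ℝ) * w ^ (1 / 8 : ℝ) * r ^ (-ε)) := by rw [h3]
    _ ≤ L ^ (1 / 4 : ℝ) * M ^ (7 / 8 : ℝ) *
          (L ^ (1 / 4 : ℝ) * M ^ (1 / 8 : ℝ) * r ^ (-ε)) := by gcongr
    _ = (L ^ (1 / 4 : ℝ) * L ^ (1 / 4 : ℝ)) * (M ^ (7 / 8 : ℝ) * M ^ (1 / 8 : ℝ)) * r ^ (-ε) := by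
        ring
    _ = _ := by rw [← h1, ← h2]

end

theorem corollary3 (ε : ℝ) (hε : 0 < ε) :
    (∃ C : ℝ, 0 < C ∧
      ∀ r j : ℕ, 0 < r → 0 < j → Nat.Coprime r j →
      ∀ L M : ℝ, 1 ≤ L → L ≤ (r : ℝ) → (r : ℝ) ^ (1 / 3 : ℝ) ≤ M → M ≤ (r : ℝ) →
      ∀ (α : ℤ → ℂ) (β : ℕ → ℂ),
        ‖bilinearSum r j L M α β‖ ≤
          C * (L ^ (1 / 2 : ℝ) * M ^ (5 / 4 : ℝ) * (r : ℝ) ^ (-(1 / 4) : ℝ)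
              + L ^ (1 / 4 : ℝ) * M ^ (7 / 8 : ℝ) * (r : ℝ) ^ (1 / 8 : ℝ))
            * norm2 L α * normInf M β * (r : ℝ) ^ ε) ∧
    (∃ δ : ℝ, 0 < δ ∧ ∃ C : ℝ, 0 < C ∧
      ∀ r j : ℕ, 0 < r → 0 < j → Nat.Coprime r j →
      ∀ L M : ℝ, (r : ℝ) ^ (1 / 3 + 3 * ε : ℝ) ≤ L → L ≤ (r : ℝ) ^ (1 - ε : ℝ) →
        (r : ℝ) ^ (1 / 3 + 3 * ε : ℝ) ≤ M → M ≤ (r : ℝ) ^ (1 - ε : ℝ) →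
      ∀ (α : ℤ → ℂ) (β : ℕ → ℂ),
        ‖bilinearSum r j L M α β‖ ≤
          C * (L ^ (1 / 2 : ℝ) * M) * norm2 L α * normInf M β * (r : ℝ) ^ (-δ)) := by
  have hn2 : ∀ L α, 0 ≤ norm2 L α := fun _ _ => Real.sqrt_nonneg _
  have hnI : ∀ M β, 0 ≤ normInf M β := fun _ _ => NNReal.coe_nonneg _
  constructor
  · obtain ⟨C, hC, h⟩ := exists_norm_bilinearSum_le ε hε
    refine ⟨C, hC, fun r j hr _ hrj L M hL hLr hM hMr α β => ?_⟩
    refine (h r j hr hrj L M hL hLr hM hMr α β).trans ?_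
    have h2 := hn2 L α
    have hI := hnI M β
    have hL0 : 0 ≤ L := by linarith
    have hM0 : 0 ≤ M := le_trans (by positivity) hM
    gcongr
    exact le_add_of_nonneg_left (by positivity)
  · obtain ⟨C, hC, h⟩ := exists_norm_bilinearSum_le (ε / 8) (by positivity)
    -- The bound is applied with `ε / 8`, so that a saving of `δ = ε` remains.
    refine ⟨ε, hε, C, hC, fun r j hr _ hrj L M hL hLr hM hMr α β => ?_⟩
    have hr1 : (1 : ℝ) ≤ r := by exact_mod_cast hr
    have hw1 : (1 : ℝ) ≤ (r : ℝ) ^ (1 / 3 + 3 * ε : ℝ) := Real.one_le_rpow hr1 (by positivity)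
    have hpow : (r : ℝ) ^ (1 - ε : ℝ) ≤ r :=
      (Real.rpow_le_rpow_of_exponent_le hr1 (by linarith)).trans_eq (Real.rpow_one _)
    have hthird : (r : ℝ) ^ (1 / 3 : ℝ) ≤ M :=
      (Real.rpow_le_rpow_of_exponent_le hr1 (by linarith)).trans hM
    have h2 := hn2 L α
    have hI := hnI M β
    refine (h r j hr hrj L M (hw1.trans hL) (hLr.trans hpow) hthird (hMr.trans hpow) α β).trans ?_
    have hs := saving_of_le (by linarith : (0 : ℝ) < r) (by linarith) (by linarith) hL hM
    calc _ = C * norm2 L α * normInf M β * (L ^ (1 / 4 : ℝ) * M ^ (7 / 8 : ℝ) *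
            (r : ℝ) ^ (1 / 8 : ℝ) * (r : ℝ) ^ (ε / 8)) := by ring
      _ ≤ C * norm2 L α * normInf M β * (L ^ (1 / 2 : ℝ) * M * (r : ℝ) ^ (-ε)) := by gcongr
      _ = _ := by ring
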